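/- Let $s\ge 2$, $1/2<\alpha\le 1$ and $S=\{1,\dots,s\}$. **Partition.** Put $(j_1,l_1)=(0,0)$, $(j_2,l_2)=(0,-1)$, $(j_d,l_d)=((d-3)/2,\,1)$ for odd $d\ge 3$ and $(j_d,l_d)=((d-4)/2,\,-2)$ for even $d\ge 4$, and let $J_d=[2^{j_d}l_d,\,2^{j_d}(l_d+1))$. The intervals $J_1,J_2,\dots$ partition $\mathbb R$; let $\mathcal P$ be the partition of $\mathbb R^s$ into the boxes $J_{d_1}\times\dots\times J_{d_s}$ with all $d_i\ge 1$. **Function class.** For $J=\prod_{i=1}^s[a_i,b_i)\in\mathcal P$ let $\gamma_\emptyset(J)=\prod_{i=1}^s\bigl(1+\min(|a_i|,|b_i|)^{\alpha+1/2}\bigr)^{-1}$ and $\gamma_u(J)=\prod_{i=1}^s\bigl(1+\min(|a_i|,|b_i|)^{2\alpha+1/2}\bigr)^{-1}$ for $\emptyset\ne u\subseteq S$. For continuous $f:\mathbb R^s\to\mathbb R$ let $V_{J,\emptyset}(f)=\bigl(\int_J|f|^2\bigr)^{1/2}$. For $\emptyset\neq u\subseteq S$ let $J_u=\prod_{i\in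 u}[a_i,b_i)$, let $f_u(x_u)=\int_{J_{S\setminus u}}f\,dx_{S\setminus u}$, and let $$V_{J,u}(f)=\sup\Bigl(\sum_{I}\mathrm{Vol}(I)\,\bigl|\Delta(f_u,I)/\mathrm{Vol}(I)^{\alpha}\bigr|^2\Bigr)^{1/2},$$ where the supremum is over all finite partitions of $J_u$ into half-open boxes $I$, and $\Delta(f_u,I)$ is the alternating sum of $f_u$ over the vertices of $I$. Let $$V(f)=\Bigl(\sum_{J\in\mathcal P}\sum_{u\subseteq S}\bigl[\gamma_u(J)^{-1}V_{J,u}(f)\bigr]^2\Bigr)^{1/2},$$ and let $H$ be the set of continuous $f:\mathbb R^s\to\mathbb R$ with $V(f)<\infty$. **Quadrature rule.** Let $t,m\ge 0$ be integers with $m>t+3s$, and let $C_1,\dots,C_s\in\mathbb Z_2^{m\times m}$ be the generating matrices of a digital $(t,m,s)$-net over $\mathbb Z_2$. Let $m_l=m-1-\lceil l/2\rceil$ for $1\le l\le 2(m-2)$ and $m_{2m-3}=m_{2m-2}=1$, so that $\sum_{l=1}^{2m-2}2^{m_l}=2^m$. For $1\le d\le 2m-2$ and $0\le k<2^{m_d}$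 put $z_{2^{m_1}+\dots+2^{m_{d-1}}+k}=2^{j_d}l_d+k\,2^{j_d-m_d}$. For $0\le n<2^m$ with binary digit vector $\vec n=(n_0,\dots,n_{m-1})^\top$, $n=\sum_k n_k2^k$, write $C_i\vec n=(\eta_{n,i,0},\dots,\eta_{n,i,m-1})^\top$ and $\eta_{n,i}=\sum_{k=0}^{m-1}\eta_{n,i,k}2^{m-1-k}$, and define the nodes $x_n=(z_{\eta_{n,1}},\dots,z_{\eta_{n,s}})$. Let $\lambda_n=\mathrm{Vol}(J)/N_J$, where $J\in\mathcal P$ is the box containing $x_n$ and $N_J$ is the number of indices $n'$ with $x_{n'}\in J$. Finally let $$e=\sup_{f\in H,\;V(f)\le 1}\Bigl|\sum_{n=0}^{2^m-1}\lambda_nf(x_n)-\int_{\mathbb R^s}f(x)\,dx\Bigr|.$$ **Claim.** Every $f\in H$ is Lebesgue integrable on $\mathbb R^s$, and $$e\le 2^{-\alpha(m-t)}\binom{m-t-2s}{s}^2\,2^{s(3\alpha+2)}\left(2^{-\alpha}+2\,(1+2^{3/2})^s\right).$$ In particular, for every $t$ there is a constant $K>0$, depending only on $s,\alpha,t$, such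 that for all $m>t+3s$, all digital $(t,m,s)$-nets over $\mathbb Z_2$ and $N=2^m$, $$e\le K\,N^{-\alpha}(\log N)^{2s}.$$ -/

import Mathlib

open MeasureTheory Set
open scoped ENNReal

noncomputable section

namespace DigitalQMC

/-! ### Elementary intervals -/

/-- The half-open box `∏ i, [x i, y i)`. -/
def box {ι : Type} (x y : ι → ℝ) : Set (ι → ℝ) :=
  Set.pi Set.univ fun i => Set.Ico (x i) (y i)

/-- Index `(j, l)` of the elementary interval `∏ i, [b ^ j i * l i, b ^ j i * (l i + 1))`. -/
abbrev BoxIdx (s : ℕ) : Type := (Fin s → ℤ) × (Fin s → ℤ)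

/-- Left end points of the elementary interval with index `p`. -/
def lo (b : ℕ) {s : ℕ} (p : BoxIdx s) (i : Fin s) : ℝ := (b : ℝ) ^ (p.1 i) * (p.2 i : ℝ)

/-- Right end points of the elementary interval with index `p`. -/
def hi (b : ℕ) {s : ℕ} (p : BoxIdx s) (i : Fin s) : ℝ := (b : ℝ) ^ (p.1 i) * ((p.2 i : ℝ) + 1)

/-- The elementary interval with index `p` in base `b`. -/
def elemInterval (b : ℕ) {s : ℕ} (p : BoxIdx s) : Set (Fin s → ℝ) := box (lo b p) (hi b p)

/-! ### Generalized variation and the function class -/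

/-- The alternating sum of `f` over the vertices of `∏ i, [x i, y i)`; the vertex `x` has sign `+`. -/
def altSum {ι : Type} [Fintype ι] [DecidableEq ι] (f : (ι → ℝ) → ℝ) (x y : ι → ℝ) : ℝ :=
  ∑ v : Finset ι, (-1) ^ v.card * f fun i => if i ∈ v then y i else x i

/-- The volume of `∏ i, [x i, y i)`. -/
def boxVol {ι : Type} [Fintype ι] (x y : ι → ℝ) : ℝ := ∏ i, (y i - x i)

/-- `P` (a finite set of pairs of corners) is a partition of `∏ i, [a i, c i)` into non-degenerate
half-open boxes. -/
def IsBoxPartition {ι : Type} (a c : ι → ℝ) (P : Finset ((ι → ℝ) × (ι → ℝ))) : Prop :=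
  (∀ I ∈ P, ∀ i, I.1 i < I.2 i) ∧
  (P : Set ((ι → ℝ) × (ι → ℝ))).PairwiseDisjoint (fun I => box I.1 I.2) ∧
  ⋃ I ∈ P, box I.1 I.2 = box a c

/-- Generalized Vitali variation of order `α` of `f` in the box `∏ i, [a i, c i)`. -/
def vitaliVar {ι : Type} [Fintype ι] [DecidableEq ι] (α : ℝ) (a c : ι → ℝ)
    (f : (ι → ℝ) → ℝ) : ℝ≥0∞ :=
  ⨆ (P : Finset ((ι → ℝ) × (ι → ℝ))) (_ : IsBoxPartition a c P),
    (∑ I ∈ P, ENNReal.ofReal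
      (boxVol I.1 I.2 * |altSum f I.1 I.2 / boxVol I.1 I.2 ^ α| ^ 2)) ^ (1 / 2 : ℝ)

/-- The point whose coordinates in `u` are those of `x` and whose other coordinates are those
of `y`. -/
def merge {s : ℕ} (u : Finset (Fin s)) (x : {i // i ∈ u} → ℝ) (y : {i // i ∉ u} → ℝ) :
    Fin s → ℝ :=
  fun i => if h : i ∈ u then x ⟨i, h⟩ else y ⟨i, h⟩

/-- `f_u (x_u) = ∫ f (x) dx_{S \ u}`, the coordinates outside `u` being integrated over the
corresponding sides of the elementary interval `p`. -/
def marginal (b : ℕ) {s : ℕ} (p : BoxIdx s) (u : Finset (Fin s)) (f : (Fin s → ℝ) → ℝ)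
    (x : {i // i ∈ u} → ℝ) : ℝ :=
  ∫ y in box (fun i : {i // i ∉ u} => lo b p i) (fun i : {i // i ∉ u} => hi b p i),
    f (merge u x y)

/-- The local variation of `f` in the elementary interval `p` for the coordinates in `u`: the
Vitali variation of order `α` of `f_u` if `u` is non-empty, and the `L²` norm of `f` on the
elementary interval if `u = ∅`. -/
def localVar (b : ℕ) {s : ℕ} (α : ℝ) (p : BoxIdx s) (u : Finset (Fin s))
    (f : (Fin s → ℝ) → ℝ) : ℝ≥0∞ :=
  if u = ∅ then (∫⁻ x in elemInterval b p, ‖f x‖ₑ ^ 2) ^ (1 / 2 : ℝ)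
  else vitaliVar α (fun i : {i // i ∈ u} => lo b p i) (fun i : {i // i ∈ u} => hi b p i)
    (marginal b p u f)

/-- Generalized Hardy--Krause variation with local smoothness `α` and local weights `γ`, with
respect to the partition of the space into the elementary intervals with index in `D`. -/
def hkVar (b : ℕ) {s : ℕ} (D : Set (BoxIdx s)) (α γ : Finset (Fin s) → BoxIdx s → ℝ)
    (f : (Fin s → ℝ) → ℝ) : ℝ≥0∞ :=
  (∑' p : D, ∑ u : Finset (Fin s),
    ((ENNReal.ofReal (γ u p))⁻¹ * localVar b (α u p) p u f) ^ 2) ^ (1 / 2 : ℝ)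

/-- The function class `H_{α,γ}`. -/
def funClass (b : ℕ) {s : ℕ} (D : Set (BoxIdx s)) (α γ : Finset (Fin s) → BoxIdx s → ℝ) :
    Set ((Fin s → ℝ) → ℝ) :=
  {f | Continuous f ∧ hkVar b D α γ f < ∞}

/-! ### Quadrature rules and the worst-case error -/

/-- The quadrature rule with nodes `x 0, …, x (N - 1)` and weights `w 0, …, w (N - 1)`. -/
def quadRule {s : ℕ} (N : ℕ) (x : ℕ → Fin s → ℝ) (w : ℕ → ℝ) (f : (Fin s → ℝ) → ℝ) : ℝ :=
  ∑ n ∈ Finset.range N, w n * f (x n)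

/-- Worst-case error of the rule in the unit ball of `H_{α,γ}`. -/
def worstCaseError (b : ℕ) {s : ℕ} (D : Set (BoxIdx s)) (α γ : Finset (Fin s) → BoxIdx s → ℝ)
    (N : ℕ) (x : ℕ → Fin s → ℝ) (w : ℕ → ℝ) : ℝ≥0∞ :=
  ⨆ (f : (Fin s → ℝ) → ℝ) (_ : f ∈ funClass b D α γ) (_ : hkVar b D α γ f ≤ 1),
    ENNReal.ofReal |quadRule N x w f - ∫ y, f y|

/-- The number of indices `n < N` for which the node `x n` lies in the elementary interval `p`. -/
def nodeCount (b : ℕ) {s : ℕ} (N : ℕ) (x : ℕ → Fin s → ℝ) (p : BoxIdx s) : ℕ :=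
  {n | n < N ∧ x n ∈ elemInterval b p}.ncard

open Classical in
/-- The weight of the node `x n`: the volume of the interval of the partition `D` that contains
`x n`, divided by the number of nodes in this interval. -/
def localWeight (b : ℕ) {s : ℕ} (D : Set (BoxIdx s)) (N : ℕ) (x : ℕ → Fin s → ℝ) (n : ℕ) : ℝ :=
  if h : ∃ p ∈ D, x n ∈ elemInterval b p then
    boxVol (lo b h.choose) (hi b h.choose) / (nodeCount b N x h.choose : ℝ)
  else 0

/-! ### Digital nets -/

/-- The vector of the first `m` base `b` digits of `n`, least significant first. -/
def digitVec (b m n : ℕ) : Fin m → ZMod b := fun k => ((n / b ^ (k : ℕ) % b : ℕ) : ZMod b)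

/-- The integer `η_0 b^(m-1) + η_1 b^(m-2) + ⋯ + η_(m-1)` where `(η_0, …, η_(m-1))` is `C`
applied to the digit vector of `n`. -/
def eta (b m : ℕ) (C : Matrix (Fin m) (Fin m) (ZMod b)) (n : ℕ) : ℕ :=
  ∑ k : Fin m, (C.mulVec (digitVec b m n) k).val * b ^ (m - 1 - (k : ℕ))

/-- The `n`-th point of the digital net in `[0,1)^s` with generating matrices `C i`; its `i`-th
coordinate is `η_0 / b + η_1 / b^2 + ⋯ + η_(m-1) / b^m`. -/
def netPoint (b m s : ℕ) (C : Fin s → Matrix (Fin m) (Fin m) (ZMod b)) (n : ℕ) : Fin s → ℝ :=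
  fun i => (eta b m (C i) n : ℝ) / (b : ℝ) ^ m

/-- The points `x 0, …, x (b^m - 1)` form a `(t,m,s)`-net in base `b`: each interval
`∏ i, [A i / b ^ d i, (A i + 1) / b ^ d i)` in `[0,1)^s` of volume `b^(t-m)` contains exactly
`b^t` of them. -/
def IsNet (b t m s : ℕ) (x : ℕ → Fin s → ℝ) : Prop :=
  t ≤ m ∧ (∀ n < b ^ m, ∀ i, x n i ∈ Set.Ico (0 : ℝ) 1) ∧
  ∀ d A : Fin s → ℕ, ∑ i, d i = m - t → (∀ i, A i < b ^ d i) →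
    {n | n < b ^ m ∧
      x n ∈ box (fun i => (A i : ℝ) / (b : ℝ) ^ d i) (fun i => ((A i : ℝ) + 1) / (b : ℝ) ^ d i)}.ncard
      = b ^ t

/-- The matrices `C i` generate a digital `(t,m,s)`-net over `ℤ_b`. -/
def IsDigitalNet (b t m s : ℕ) (C : Fin s → Matrix (Fin m) (Fin m) (ZMod b)) : Prop :=
  IsNet b t m s (netPoint b m s C)

/-! ### The construction of nodes in `ℝ^s` -/

/-- The one-dimensional node with label `n`. The intervals `[b^j_d l_d, b^j_d (l_d + 1))`,
`d = 1, 2, …`, where `jl d = (j_d, l_d)`, receive in this order `b^(c d)` equally spaced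
left-centred nodes, labelled consecutively from `0`. The interval that holds the label `n` is the
first one with `n < b^(c 1) + ⋯ + b^(c d)`. -/
def zPoint (b : ℕ) (jl : ℕ → ℤ × ℤ) (c : ℕ → ℕ) (n : ℕ) : ℝ :=
  let d : ℕ := sInf {d | n < ∑ e ∈ Finset.Icc 1 d, b ^ c e}
  let k : ℕ := n - ∑ e ∈ Finset.Ico 1 d, b ^ c e
  (b : ℝ) ^ (jl d).1 * ((jl d).2 : ℝ) + (k : ℝ) * (b : ℝ) ^ ((jl d).1 - (c d : ℤ))

/-- The `n`-th node in `ℝ^s`: the coordinate `i` of the digital net is replaced by the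
one-dimensional node with the same label. -/
def node (b m s : ℕ) (jl : Fin s → ℕ → ℤ × ℤ) (c : Fin s → ℕ → ℕ)
    (C : Fin s → Matrix (Fin m) (Fin m) (ZMod b)) (n : ℕ) : Fin s → ℝ :=
  fun i => zPoint b (jl i) (c i) (eta b m (C i) n)

/-! ### Rational decay of the weights -/

/-- The pairs `(j_d, l_d)`, `d ≥ 1`, of the dyadic partition of `ℝ` into `[0,1)`, `[-1,0)`,
`[2^j, 2^(j+1))` and `[-2^(j+1), -2^j)` for `j ≥ 0`. -/
def ratIdx (d : ℕ) : ℤ × ℤ :=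
  if d = 1 then (0, 0)
  else if d = 2 then (0, -1)
  else if Odd d then (((d : ℤ) - 3) / 2, 1)
  else (((d : ℤ) - 4) / 2, -2)

/-- The product partition of `ℝ^s`. -/
def ratPartition (s : ℕ) : Set (BoxIdx s) :=
  {p | ∀ i, ∃ d : ℕ, 1 ≤ d ∧ (p.1 i, p.2 i) = ratIdx d}

/-- `m_l = m - 1 - ⌈l/2⌉` for `1 ≤ l ≤ 2 (m - 2)` and `m_l = 1` for `l = 2 m - 3, 2 m - 2`;
these `2 m - 2` numbers satisfy `∑ 2^(m_l) = 2^m`, so that later values are not used. -/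
def ratCount (m l : ℕ) : ℕ := if l ≤ 2 * (m - 2) then m - 1 - (l + 1) / 2 else 1

/-- Constant smoothness. -/
def constSmooth (s : ℕ) (α : ℝ) : Finset (Fin s) → BoxIdx s → ℝ := fun _ _ => α

/-- Rationally decaying weights; the product runs over all coordinates for every `u`. -/
def ratWeight (s : ℕ) (α : ℝ) : Finset (Fin s) → BoxIdx s → ℝ := fun u p =>
  if u = ∅ then ∏ i, (1 + min |lo 2 p i| |hi 2 p i| ^ (α + 1 / 2))⁻¹
  else ∏ i, (1 + min |lo 2 p i| |hi 2 p i| ^ (2 * α + 1 / 2))⁻¹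

/-- The nodes constructed from the digital net with generating matrices `C`. -/
def ratNode (m s : ℕ) (C : Fin s → Matrix (Fin m) (Fin m) (ZMod 2)) : ℕ → Fin s → ℝ :=
  node 2 m s (fun _ => ratIdx) (fun _ => ratCount m) C

/-- The worst-case error of the constructed rule with `2^m` nodes. -/
def ratError (m s : ℕ) (α : ℝ) (C : Fin s → Matrix (Fin m) (Fin m) (ZMod 2)) : ℝ≥0∞ :=
  worstCaseError 2 (ratPartition s) (constSmooth s α) (ratWeight s α) (2 ^ m) (ratNode m s C)
    (localWeight 2 (ratPartition s) (2 ^ m) (ratNode m s C))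

end DigitalQMC

end

/-!
The error is a sum over the boxes `J` of the partition of the differences between the part of the
rule and the part of the integral that belong to `J`. A box is numbered by `d : Fin s → ℕ`, and
`e = d / 2` measures its distance from the origin: its sides have lengths about `2 ^ e i`. Put
`L = m - t - 2 s`.

*Distribution of the nodes.* The labels of the nodes in a dyadic cell of `J` fill an elementary
interval of the net, so if `|e| ≤ L`, then all dyadic cells of `J` of levels `r` with
`|r| ≤ M = L - |e|` contain equally many nodes (`nodesIn_evenlyDistributed`). A box with `|e| > L`
may contain nodes or not; in the first case `M = 0` is used.

*One box with nodes.* Let `y` run through `J`, and let the resolution `pt_r(x, y)` of level `r` of a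
coordinate `x` be the point in the cell of `x` of level `r` that corresponds to `y` (`resolve`).
Averaging `f` at these points over `y` and over the nodes gives a function `φ` of the level vector
`r`. It equals the mean of `f` over `J` if `|r| ≤ M`, and the mean over the nodes if full resolution
is taken in each coordinate. Telescoping the identity coordinate by coordinate, with a hyperbolic
cross as index set, writes the difference of the two as a sum of products of differences of
resolutions (`abs_map_top_sub_le`). In such a product, the coordinates outside a set `u` are
integrated out, which produces the marginal `f_u`, while the coordinates in `u` produce an
alternating sum of `f_u` over a box in the cell of the node. These boxes, one for each cell, can be
completed to a partition, so that the Vitali variation bounds the sum of their squares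
(`sum_sq_altSum_le`). Since the boxes have volume at most `2 ^ (-|ρ|) Vol(J_u)`, no sum over further
levels is needed and the bound stays uniform as `α` tends to `1 / 2`
(`abs_boxVol_mul_sum_sub_integral_le`).

*One box without nodes.* Then the error is the integral of `f`, which the `L²` norm controls.

*Summation.* The weights compensate the sizes of the boxes up to a factor `2 ^ (α (s - |e|))`
(`prod_rpow_mul_prod_le`). Hence the error in `J` is at most a multiple of `2 ^ (-α L)` times
`2 ^ (-α (|e| - L)_+)` times the weighted variations (`enorm_localRule_sub_le`), and the
Cauchy-Schwarz inequality together with `∑_d 2 ^ (-(|e| - L)_+) = 2 ^ s ∑_{j ≤ s} C(L + s, j)`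
(`tsum_decay`) gives the claim once the binomial sums are compared with `C(L, s)`, which uses
`L ≥ s + 1`. Integrability follows in the same way from the `L²` norms alone.
-/

noncomputable section

namespace DigitalQMC

/-! ### Binomial sums -/

/-- The number `∑_{j < k} C(M, j)` of subsets of an `M`-element set with fewer than `k` elements. -/
def binomSum (k M : ℕ) : ℕ := ∑ j ∈ Finset.range k, M.choose j

lemma binomSum_succ (k M : ℕ) : binomSum (k + 1) (M + 1) = binomSum (k + 1) M + binomSum k M := by
  unfold binomSum
  rw [Finset.sum_range_succ', Finset.sum_range_succ' _ k]
  simp only [Nat.choose_succ_succ, Finset.sum_add_distrib, Nat.choose_zero_right]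
  ring

lemma one_add_sum_binomSum (k M : ℕ) :
    1 + ∑ ρ ∈ Finset.range M, binomSum k ρ = binomSum (k + 1) M := by
  induction M with
  | zero => simp [binomSum, Finset.sum_range_succ']
  | succ M ih => rw [Finset.sum_range_succ, ← add_assoc, ih, binomSum_succ]

lemma binomSum_mono {k k' M M' : ℕ} (hk : k ≤ k') (hM : M ≤ M') :
    binomSum k M ≤ binomSum k' M' := by
  unfold binomSum
  refine (Finset.sum_le_sum fun j _ => Nat.choose_le_choose j hM).trans ?_
  exact Finset.sum_le_sum_of_subset (Finset.range_subset_range.2 hk)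

/-- A comparison of the growth of `C(N, j)` in `N` with that of `C(L, s)` in `L`. -/
lemma choose_mul_choose_succ_le {L s N j : ℕ} (hs : s ≤ L) (hj : j ≤ N)
    (h : (N + 1) * (L + 1 - s) ≤ (L + 1) * (N + 1 - j)) :
    (N + 1).choose j * L.choose s ≤ N.choose j * (L + 1).choose s := by
  have h1 := Nat.choose_mul_succ_eq N j
  have h2 := Nat.choose_mul_succ_eq L s
  have hp : 0 < (N + 1 - j) * (L + 1 - s) := Nat.mul_pos (by omega) (by omega)
  refine Nat.le_of_mul_le_mul_right ?_ hp
  calc (N + 1).choose j * L.choose s * ((N + 1 - j) * (L + 1 - s))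
      = ((N + 1).choose j * (N + 1 - j)) * (L.choose s * (L + 1 - s)) := by ring
    _ = (N.choose j * L.choose s) * ((N + 1) * (L + 1 - s)) := by rw [← h1]; ring
    _ ≤ (N.choose j * L.choose s) * ((L + 1) * (N + 1 - j)) := Nat.mul_le_mul_left _ h
    _ = N.choose j * (L.choose s * (L + 1)) * (N + 1 - j) := by ring
    _ = N.choose j * (L + 1).choose s * ((N + 1 - j) * (L + 1 - s)) := by rw [h2]; ring

/-- Both sides are compared through their growth in `L`: each `C(L, j)` with `j < s` grows at a
slower rate than `C(L, s)`, and for `L = s + 1` the left-hand side is at most `2 ^ (s + 1)`. -/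
lemma binomSum_le_two_pow_mul_choose {s L : ℕ} (hs : 1 ≤ s) (hL : s + 1 ≤ L) :
    binomSum s L ≤ 2 ^ s * L.choose s := by
  induction L, hL using Nat.le_induction with
  | base =>
    have h1 : binomSum s (s + 1) ≤ 2 ^ (s + 1) := by
      rw [← Nat.sum_range_choose]
      exact Finset.sum_le_sum_of_subset (Finset.range_subset_range.2 (by omega))
    have h2 : (s + 1).choose s = s + 1 := by simp
    rw [h2]
    refine h1.trans ?_
    rw [pow_succ]
    exact Nat.mul_le_mul_left _ (by omega)
  | succ L hL ih =>
    have hpos : 0 < L.choose s := Nat.choose_pos (by omega)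
    refine Nat.le_of_mul_le_mul_right ?_ hpos
    calc binomSum s (L + 1) * L.choose s
        = ∑ j ∈ Finset.range s, (L + 1).choose j * L.choose s := by
          rw [binomSum, Finset.sum_mul]
      _ ≤ ∑ j ∈ Finset.range s, L.choose j * (L + 1).choose s := by
          refine Finset.sum_le_sum fun j hj => ?_
          rw [Finset.mem_range] at hj
          refine choose_mul_choose_succ_le (by omega) (by omega) ?_
          exact Nat.mul_le_mul_left _ (by omega)
      _ = binomSum s L * (L + 1).choose s := by rw [binomSum, Finset.sum_mul]
      _ ≤ 2 ^ s * L.choose s * (L + 1).choose s := Nat.mul_le_mul_right _ ih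
      _ = 2 ^ s * (L + 1).choose s * L.choose s := by ring

/-- At `L = s + 1` the left-hand side is half of a full row sum, and each of its terms grows in `L`
at a slower rate than `C(L, s)`. -/
lemma binomSum_add_le_four_pow_mul_choose {s L : ℕ} (hL : s + 1 ≤ L) :
    binomSum (s + 1) (L + s) ≤ 4 ^ s * L.choose s := by
  induction L, hL using Nat.le_induction with
  | base =>
    have h1 : binomSum (s + 1) (s + 1 + s) = 4 ^ s := by
      rw [← Nat.sum_range_choose_halfway, binomSum]
      congr 1; ext j; congr 1; omega
    rw [h1]
    exact Nat.le_mul_of_pos_right _ (Nat.choose_pos (by omega))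
  | succ L hL ih =>
    have hpos : 0 < L.choose s := Nat.choose_pos (by omega)
    refine Nat.le_of_mul_le_mul_right ?_ hpos
    calc binomSum (s + 1) (L + 1 + s) * L.choose s
        = ∑ j ∈ Finset.range (s + 1), (L + s + 1).choose j * L.choose s := by
          rw [binomSum, Finset.sum_mul]
          congr 1; ext j; congr 2; omega
      _ ≤ ∑ j ∈ Finset.range (s + 1), (L + s).choose j * (L + 1).choose s := by
          refine Finset.sum_le_sum fun j hj => ?_
          rw [Finset.mem_range] at hj
          refine choose_mul_choose_succ_le (by omega) (by omega) ?_
          have h3 : (L + 1) * (L + 1) ≤ (L + 1) * (L + s + 1 - j) :=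
            Nat.mul_le_mul_left _ (by omega)
          refine le_trans ?_ h3
          zify [show s ≤ L + 1 by omega]
          nlinarith [sq_nonneg (s : ℤ)]
      _ = binomSum (s + 1) (L + s) * (L + 1).choose s := by rw [binomSum, Finset.sum_mul]
      _ ≤ 4 ^ s * L.choose s * (L + 1).choose s := Nat.mul_le_mul_right _ ih
      _ = 4 ^ s * (L + 1).choose s * L.choose s := by ring

/-- Summation over the first coordinate of the identity for `∑_e 2 ^ (-(|e| - L)_+)`. -/
lemma sum_binomSum_add (s L : ℕ) :
    ∑ j ∈ Finset.range (L + 1), binomSum (s + 1) (j + s) + 2 ^ s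
      = binomSum (s + 2) (L + (s + 1)) := by
  have h0 : ∀ s, binomSum (s + 1) s = 2 ^ s := fun s => Nat.sum_range_choose s
  induction L with
  | zero => simp only [zero_add, Finset.sum_range_one]; rw [h0, h0]; ring
  | succ L ih =>
    rw [Finset.sum_range_succ, add_right_comm, ih,
      show L + 1 + (s + 1) = (L + (s + 1)) + 1 by ring, binomSum_succ]
    congr 2; ring

/-! ### Telescoping over levels of resolution -/

/-- The increments of a sequence, the first one being its initial value. -/
def detail {E : Type} [AddCommGroup E] (δ : ℕ → E) : ℕ → E
  | 0 => δ 0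
  | r + 1 => δ (r + 1) - δ r

lemma sum_detail {E : Type} [AddCommGroup E] (δ : ℕ → E) (k : ℕ) :
    ∑ ρ ∈ Finset.range (k + 1), detail δ ρ = δ k := by
  induction k with
  | zero => simp [detail]
  | succ k ih => rw [Finset.sum_range_succ, ih]; simp [detail]

section Telescoping

variable {ι : Type} [Fintype ι] [DecidableEq ι] {E : Type} [AddCommGroup E] [Module ℝ E]

/-- The coordinates at which a vector of levels is non-zero. -/
def levelSupp (r : ι → ℕ) : Finset ι := Finset.univ.filter fun i => r i ≠ 0

/-- If a multilinear form takes the same value at all vectors of levels of sum at most `M`, then it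
vanishes at the increments of these levels, except at level zero. -/
lemma map_piecewise_detail (Φ : MultilinearMap ℝ (fun _ : ι => E) ℝ) (δ : ℕ → E) (M : ℕ) (φ₀ : ℝ)
    (hex : ∀ r : ι → ℕ, ∑ i, r i ≤ M → Φ (fun i => δ (r i)) = φ₀) (T : Finset ι) :
    ∀ r : ι → ℕ, ∑ i, r i ≤ M →
      Φ (T.piecewise (fun i => detail δ (r i)) (fun i => δ (r i)))
        = if ∀ i ∈ T, r i = 0 then φ₀ else 0 := by
  induction T using Finset.induction_on with
  | empty => intro r hr; simpa using hex r hr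
  | insert i T hi ih =>
    intro r hr
    rw [Finset.piecewise_insert]
    rcases hri : r i with _ | k
    · have h1 : Function.update (T.piecewise (fun i => detail δ (r i)) (fun i => δ (r i))) i
          (detail δ 0) = T.piecewise (fun i => detail δ (r i)) (fun i => δ (r i)) := by
        ext j
        rcases eq_or_ne j i with rfl | hj
        · simp [hi, hri, detail]
        · simp [hj]
      rw [h1, ih r hr]
      simp [hri]
    · set r' := Function.update r i k with hr'
      have hle : ∑ j, r' j ≤ M := by
        refine (Finset.sum_le_sum fun j _ => ?_).trans hr
        rcases eq_or_ne j i with rfl | hj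
        · simp [hr', hri]
        · simp [hr', hj]
      have h1 : Function.update (T.piecewise (fun i => detail δ (r i)) (fun i => δ (r i))) i
          (δ (k + 1)) = T.piecewise (fun i => detail δ (r i)) (fun i => δ (r i)) := by
        ext j
        rcases eq_or_ne j i with rfl | hj
        · simp [hi, hri]
        · simp [hj]
      have h2 : Function.update (T.piecewise (fun i => detail δ (r i)) (fun i => δ (r i))) i
          (δ k) = T.piecewise (fun i => detail δ (r' i)) (fun i => δ (r' i)) := by
        ext j
        rcases eq_or_ne j i with rfl | hj
        · simp [hi, hr']
        · by_cases hjT : j ∈ T <;> simp [hj, hr', hjT]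
      have h3 : (∀ j ∈ T, r' j = 0) ↔ ∀ j ∈ T, r j = 0 := by
        refine forall₂_congr fun j hj => ?_
        have : j ≠ i := fun h => hi (h ▸ hj)
        simp [hr', this]
      rw [show detail δ (k + 1) = δ (k + 1) - δ k from rfl, MultilinearMap.map_update_sub, h1, h2,
        ih r hr, ih r' hle]
      simp [h3, hri]

/-- One step of the telescoping argument: the levels of all coordinates in `R` are still at their
maximal value, and the levels of the others have used up `M - M'` of the budget. -/
lemma abs_map_piecewise_sub_le (Φ : MultilinearMap ℝ (fun _ : ι => E) ℝ) (δ : ℕ → E) (M : ℕ)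
    (φ₀ : ℝ) (B : Finset ι → ℝ) (hB : ∀ u, 0 ≤ B u) (q : ℝ) (hq : 0 < q) (hq1 : q ≤ 1)
    (hex : ∀ r : ι → ℕ, ∑ i, r i ≤ M → Φ (fun i => δ (r i)) = φ₀)
    (hleaf : ∀ u : Finset ι, u.Nonempty → ∀ ρ a b : ι → ℕ, ∑ i ∈ u, ρ i ≤ M →
      (∀ i ∈ u, ρ i ≤ a i ∧ ρ i ≤ b i ∧ a i ≤ M + 1 ∧ b i ≤ M + 1) →
      |Φ (u.piecewise (fun i => δ (a i) - δ (b i)) (fun _ => δ 0))| ≤ B u * q ^ ∑ i ∈ u, ρ i)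
    (R : Finset ι) : ∀ r : ι → ℕ, (∀ i ∈ R, r i = 0) → ∀ M', ∑ i, r i + M' = M →
      |Φ (R.piecewise (fun _ => δ (M + 1)) (fun i => detail δ (r i)))
          - (if r = 0 then φ₀ else 0)|
        ≤ ∑ w ∈ R.powerset, B (levelSupp r ∪ w) * (q ^ M * q⁻¹ ^ (levelSupp r ∪ w).card)
            * (binomSum w.card M' : ℝ) := by
  set β : Finset ι → ℝ := fun u => B u * (q ^ M * q⁻¹ ^ u.card) with hβ
  have hβ0 : ∀ u, 0 ≤ β u := fun u => mul_nonneg (hB u) (by positivity)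
  induction R using Finset.induction_on with
  | empty =>
    intro r _ M' hM
    have h := map_piecewise_detail Φ δ M φ₀ hex Finset.univ r (by omega)
    have h2 : (∀ i ∈ Finset.univ, r i = 0) ↔ r = 0 := by simp [funext_iff]
    simp only [Finset.piecewise_univ, h2] at h
    simp [h, binomSum]
  | insert i R hi ih =>
    intro r hr M' hM
    have hri : r i = 0 := hr i (by simp)
    have hrR : ∀ k ∈ R, r k = 0 := fun k hk => hr k (by simp [hk])
    set c := R.piecewise (fun _ => δ (M + 1)) (fun i => detail δ (r i)) with hc
    set S := levelSupp r with hS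
    -- the bound for a fixed level `ρ` of the coordinate `i`
    have hρ : ∀ ρ ∈ Finset.range (M' + 1),
        |Φ (Function.update c i (detail δ ρ))
          - (if Function.update r i ρ = 0 then φ₀ else 0)|
        ≤ ∑ w ∈ R.powerset, β (levelSupp (Function.update r i ρ) ∪ w)
            * (binomSum w.card (M' - ρ) : ℝ) := by
      intro ρ hρ
      rw [Finset.mem_range] at hρ
      have h1 : Function.update c i (detail δ ρ)
          = R.piecewise (fun _ => δ (M + 1)) (fun k => detail δ (Function.update r i ρ k)) := by
        ext k
        rcases eq_or_ne k i with rfl | hk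
        · simp [hi]
        · by_cases hkR : k ∈ R <;> simp [hc, hk, hkR]
      rw [h1]
      refine ih _ (fun k hk => ?_) _ ?_
      · have : k ≠ i := fun h => hi (h ▸ hk)
        simp [this, hrR k hk]
      · rw [Finset.sum_update_of_mem (Finset.mem_univ i)]
        have := Finset.add_sum_erase Finset.univ r (Finset.mem_univ i)
        rw [Finset.sdiff_singleton_eq_erase]
        omega
    have hsupp0 : levelSupp (Function.update r i 0) = S := by
      rw [← hri, Function.update_eq_self]
    have hsupp : ∀ ρ, levelSupp (Function.update r i (ρ + 1)) = insert i S := by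
      intro ρ
      ext k
      rcases eq_or_ne k i with rfl | hk <;> simp [levelSupp, *]
    -- the bound for the remainder at the coordinate `i`
    have hrest : |Φ (Function.update c i (δ (M + 1) - δ M'))|
        ≤ ∑ w ∈ R.powerset, β (S ∪ insert i w) := by
      -- in the coordinates in `R`, full resolution is level zero plus the difference to it
      set m' : ι → E := Function.update (fun k => detail δ (r k)) i (δ (M + 1) - δ M') with hm'
      have h1 : Function.update c i (δ (M + 1) - δ M')
          = R.piecewise ((fun _ => δ (M + 1) - δ 0) + m') m' := by
        ext k
        rcases eq_or_ne k i with rfl | hk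
        · simp [hi, hm']
        · by_cases hkR : k ∈ R
          · simp [hc, hk, hkR, hm', hrR k hkR, detail]
          · simp [hc, hk, hkR, hm']
      rw [h1, MultilinearMap.map_piecewise_add]
      refine (Finset.abs_sum_le_sum_abs _ _).trans (Finset.sum_le_sum fun w hw => ?_)
      rw [Finset.mem_powerset] at hw
      have hiw : i ∉ w := fun h => hi (hw h)
      set u := S ∪ insert i w with hu
      set ρ : ι → ℕ := fun k => if k = i then M' else r k - 1 with hρdef
      have hrw : ∀ k ∈ w, r k = 0 := fun k hk => hrR k (hw hk)
      have h2 : w.piecewise (fun _ => δ (M + 1) - δ 0) m'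
          = u.piecewise (fun k => δ (if k = i ∨ k ∈ w then M + 1 else r k) - δ (ρ k))
            (fun _ => δ 0) := by
        ext k
        rcases eq_or_ne k i with rfl | hk
        · simp [hiw, hm', hu, hρdef]
        · by_cases hkw : k ∈ w
          · simp [hkw, hu, hρdef, hk, hrw k hkw]
          · rcases hrk : r k with _ | n
            · simp [hkw, hu, hm', hk, hrk, hS, levelSupp, detail]
            · simp [hkw, hu, hm', hk, hrk, hS, levelSupp, detail, hρdef]
      have hle : ∀ k, r k ≤ M := fun k =>
        (Finset.single_le_sum (f := r) (fun _ _ => Nat.zero_le _) (Finset.mem_univ k)).trans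
          (by omega)
      have hsub : ∀ k, ρ k ≤ (if k = i then M' else 0) + r k := by
        intro k; simp only [hρdef]; split_ifs <;> omega
      have hsum : ∑ k ∈ u, ρ k ≤ M := by
        calc ∑ k ∈ u, ρ k ≤ ∑ k, ρ k :=
              Finset.sum_le_sum_of_subset (Finset.subset_univ _)
          _ ≤ ∑ k, ((if k = i then M' else 0) + r k) := Finset.sum_le_sum fun k _ => hsub k
          _ = M := by rw [Finset.sum_add_distrib]; simp; omega
      have hsum' : M ≤ ∑ k ∈ u, ρ k + u.card := by
        have hzero : ∀ k ∉ u, (if k = i then M' else 0) + r k = 0 := by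
          intro k hk
          simp only [hu, hS, levelSupp, Finset.mem_union, Finset.mem_filter, Finset.mem_univ,
            true_and, Finset.mem_insert, not_or, not_not] at hk
          simp [hk.1, hk.2.1]
        calc M = ∑ k, ((if k = i then M' else 0) + r k) := by
              rw [Finset.sum_add_distrib]; simp; omega
          _ = ∑ k ∈ u, ((if k = i then M' else 0) + r k) :=
              (Finset.sum_subset (Finset.subset_univ u) fun k _ hk => hzero k hk).symm
          _ ≤ ∑ k ∈ u, (ρ k + 1) := by
              refine Finset.sum_le_sum fun k _ => ?_
              simp only [hρdef]
              split_ifs with hk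
              · subst hk; omega
              · omega
          _ = _ := by rw [Finset.sum_add_distrib]; simp
      rw [h2]
      refine (hleaf u ⟨i, by simp [hu]⟩ ρ _ ρ hsum fun k hk => ⟨?_, le_rfl, ?_, ?_⟩).trans ?_
      · have := hle k
        by_cases hk1 : k = i
        · simp only [hρdef, hk1, true_or, if_true]; omega
        · by_cases hk2 : k ∈ w
          · simp only [hρdef, hk1, hk2, or_true, if_true, if_false]; omega
          · simp only [hρdef, hk1, hk2, or_false, if_false]; omega
      · split_ifs
        · exact le_rfl
        · have := hle k; omega
      · simp only [hρdef]
        split_ifs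
        · omega
        · have := hle k; omega
      · refine mul_le_mul_of_nonneg_left ?_ (hB u)
        have h3 : q ^ (∑ k ∈ u, ρ k) = q ^ (∑ k ∈ u, ρ k + u.card) * q⁻¹ ^ u.card := by
          rw [pow_add, mul_assoc, ← mul_pow, mul_inv_cancel₀ hq.ne', one_pow, mul_one]
        rw [h3]
        exact mul_le_mul_of_nonneg_right (pow_le_pow_of_le_one hq.le hq1 hsum') (by positivity)
    -- the telescoping identity at the coordinate `i`
    have hsplit : Φ ((insert i R).piecewise (fun _ => δ (M + 1)) (fun i => detail δ (r i)))
          - (if r = 0 then φ₀ else 0)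
        = ∑ ρ ∈ Finset.range (M' + 1), (Φ (Function.update c i (detail δ ρ))
            - (if Function.update r i ρ = 0 then φ₀ else 0))
          + Φ (Function.update c i (δ (M + 1) - δ M')) := by
      have h1 : ∑ ρ ∈ Finset.range (M' + 1),
          (if Function.update r i ρ = 0 then φ₀ else 0) = if r = 0 then φ₀ else 0 := by
        rw [Finset.sum_eq_single 0]
        · rw [← hri, Function.update_eq_self]
        · intro ρ _ hρ0
          rw [if_neg]
          intro h
          exact hρ0 (by simpa using congrFun h i)
        · simp
      rw [Finset.piecewise_insert, Finset.sum_sub_distrib, h1, ← MultilinearMap.map_update_sum,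
        sum_detail, MultilinearMap.map_update_sub]
      ring
    rw [hsplit]
    refine (abs_add_le _ _).trans ?_
    have hA : |∑ ρ ∈ Finset.range (M' + 1), (Φ (Function.update c i (detail δ ρ))
            - (if Function.update r i ρ = 0 then φ₀ else 0))|
        ≤ ∑ ρ ∈ Finset.range (M' + 1), ∑ w ∈ R.powerset,
            β (levelSupp (Function.update r i ρ) ∪ w) * (binomSum w.card (M' - ρ) : ℝ) :=
      (Finset.abs_sum_le_sum_abs _ _).trans (Finset.sum_le_sum hρ)
    refine (add_le_add hA hrest).trans (le_of_eq ?_)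
    rw [Finset.sum_powerset_insert hi, Finset.sum_range_succ', hsupp0, Nat.sub_zero,
      add_comm (∑ k ∈ Finset.range M', _), add_assoc]
    congr 1
    rw [Finset.sum_comm, ← Finset.sum_add_distrib]
    refine Finset.sum_congr rfl fun w hw => ?_
    have hiw : i ∉ w := fun h => hi (Finset.mem_powerset.1 hw h)
    have h4 : ∑ k ∈ Finset.range M', (binomSum w.card (M' - (k + 1)) : ℝ)
        = ∑ k ∈ Finset.range M', (binomSum w.card k : ℝ) := by
      rw [← Finset.sum_range_reflect]
      refine Finset.sum_congr rfl fun k hk => ?_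
      rw [Finset.mem_range] at hk
      congr 2
      omega
    have h5 := one_add_sum_binomSum w.card M'
    simp only [hsupp, Finset.insert_union, Finset.union_insert]
    rw [← Finset.mul_sum, h4, Finset.card_insert_of_notMem hiw, ← h5]
    push_cast
    ring

/-- Telescoping over hyperbolic crosses. Suppose a multilinear form `Φ` has the value `φ₀` at all
vectors of levels of sum at most `M`, and is small at products of differences of levels. Then its
value at the maximal level `M + 1` is close to `φ₀`. -/
lemma abs_map_top_sub_le (Φ : MultilinearMap ℝ (fun _ : ι => E) ℝ) (δ : ℕ → E) (M : ℕ)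
    (φ₀ : ℝ) (B : Finset ι → ℝ) (hB : ∀ u, 0 ≤ B u) (q : ℝ) (hq : 0 < q) (hq1 : q ≤ 1)
    (hex : ∀ r : ι → ℕ, ∑ i, r i ≤ M → Φ (fun i => δ (r i)) = φ₀)
    (hleaf : ∀ u : Finset ι, u.Nonempty → ∀ ρ a b : ι → ℕ, ∑ i ∈ u, ρ i ≤ M →
      (∀ i ∈ u, ρ i ≤ a i ∧ ρ i ≤ b i ∧ a i ≤ M + 1 ∧ b i ≤ M + 1) →
      |Φ (u.piecewise (fun i => δ (a i) - δ (b i)) (fun _ => δ 0))| ≤ B u * q ^ ∑ i ∈ u, ρ i) :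
    |Φ (fun _ => δ (M + 1)) - φ₀|
      ≤ ∑ u : Finset ι, B u * (q ^ M * q⁻¹ ^ u.card) * (binomSum u.card M : ℝ) := by
  have h := abs_map_piecewise_sub_le Φ δ M φ₀ B hB q hq hq1 hex hleaf Finset.univ 0
    (fun _ _ => rfl) M (by simp)
  simpa [levelSupp] using h

end Telescoping

/-! ### Alternating sums over the vertices of a box -/

section AltSum

variable {ι : Type} [Fintype ι] [DecidableEq ι]

/-- Exchanging the end points in one coordinate changes the sign of the alternating sum. -/
lemma altSum_update_swap (g : (ι → ℝ) → ℝ) (p q : ι → ℝ) (i : ι) :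
    altSum g (Function.update p i (q i)) (Function.update q i (p i)) = -altSum g p q := by
  unfold altSum
  have hinv : Function.Involutive fun v : Finset ι => if i ∈ v then v.erase i else insert i v := by
    intro v
    by_cases h : i ∈ v <;> simp [h]
  set e := Function.Involutive.toPerm _ hinv with he
  rw [← Equiv.sum_comp e, ← Finset.sum_neg_distrib]
  refine Finset.sum_congr rfl fun v _ => ?_
  have hsign : ((-1 : ℝ) ^ (e v).card) = -(-1) ^ v.card := by
    by_cases h : i ∈ v
    · have h1 := Finset.card_erase_add_one h
      simp only [he, Function.Involutive.coe_toPerm, h, if_true]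
      rw [← h1, pow_succ]; ring
    · simp [he, h, Finset.card_insert_of_notMem, pow_succ]
  have harg : (fun j => if j ∈ e v then Function.update q i (p i) j
      else Function.update p i (q i) j) = fun j => if j ∈ v then q j else p j := by
    ext j
    rcases eq_or_ne j i with rfl | hj
    · by_cases h : j ∈ v <;> simp [he, h]
    · by_cases h : i ∈ v <;> simp [he, h, hj]
  rw [hsign, harg]
  ring

lemma altSum_eq_zero (g : (ι → ℝ) → ℝ) (p q : ι → ℝ) (i : ι) (h : p i = q i) :
    altSum g p q = 0 := by
  have h1 := altSum_update_swap g p q i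
  rw [← h, Function.update_eq_self, h, Function.update_eq_self] at h1
  linarith

lemma abs_altSum_piecewise (g : (ι → ℝ) → ℝ) (p q : ι → ℝ) (W : Finset ι) :
    |altSum g (W.piecewise q p) (W.piecewise p q)| = |altSum g p q| := by
  induction W using Finset.induction_on with
  | empty => simp
  | insert i W hi ih =>
    have h := altSum_update_swap g (W.piecewise q p) (W.piecewise p q) i
    simp only [Finset.piecewise_eq_of_notMem _ _ _ hi] at h
    rw [← ih, Finset.piecewise_insert, Finset.piecewise_insert, h, abs_neg]

lemma abs_altSum_inf_sup (g : (ι → ℝ) → ℝ) (p q : ι → ℝ) :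
    |altSum g (p ⊓ q) (p ⊔ q)| = |altSum g p q| := by
  rw [← abs_altSum_piecewise g p q (Finset.univ.filter fun i => q i < p i)]
  congr 2
  · ext i
    by_cases h : q i < p i
    · simp [h, h.le]
    · simp [h, not_lt.1 h]
  · ext i
    by_cases h : q i < p i
    · simp [h, h.le]
    · simp [h, not_lt.1 h]

end AltSum

/-! ### Dyadic cells of a side of a box -/

/-- The left end point of the `k`-th of the `2 ^ r` equal parts of `[a, a + len)`. -/
def cellLo (a len : ℝ) (r k : ℕ) : ℝ := a + len * (k / 2 ^ r)

/-- The index of the part of `[a, a + len)` of level `r` that contains `x`. -/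
def cellIdx (a len : ℝ) (r : ℕ) (x : ℝ) : ℕ := ⌊(x - a) / len * 2 ^ r⌋₊

lemma mem_Ico_cellLo_iff {a len x : ℝ} (hlen : 0 < len) (hx : a ≤ x) (r k : ℕ) :
    x ∈ Ico (cellLo a len r k) (cellLo a len r (k + 1)) ↔ cellIdx a len r x = k := by
  have h0 : 0 ≤ (x - a) / len * 2 ^ r :=
    mul_nonneg (div_nonneg (by linarith) hlen.le) (by positivity)
  have e1 : ∀ y : ℝ, a + len * (y / 2 ^ r) ≤ x ↔ y ≤ (x - a) / len * 2 ^ r := by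
    intro y
    rw [div_mul_eq_mul_div, le_div_iff₀ hlen, ← le_sub_iff_add_le', ← mul_div_assoc,
      div_le_iff₀ (by positivity), mul_comm]
  rw [cellIdx, Nat.floor_eq_iff h0, mem_Ico, cellLo, cellLo, e1, ← not_le, e1, not_le]
  push_cast
  rfl

lemma cellLo_zero (a len : ℝ) (r : ℕ) : cellLo a len r 0 = a := by simp [cellLo]

lemma cellLo_mono {a len : ℝ} (hlen : 0 < len) (r : ℕ) : Monotone (cellLo a len r) := by
  intro k k' h
  unfold cellLo
  gcongr

lemma cellLo_two_pow (a len : ℝ) (r : ℕ) : cellLo a len r (2 ^ r) = a + len := by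
  simp [cellLo]

lemma cellIdx_lt {a len x : ℝ} (hlen : 0 < len) (hx : a ≤ x) (hx' : x < a + len) (r : ℕ) :
    cellIdx a len r x < 2 ^ r := by
  by_contra! h
  have h1 := ((mem_Ico_cellLo_iff hlen hx r _).2 rfl).1
  have h2 := cellLo_mono (a := a) hlen r h
  rw [cellLo_two_pow] at h2
  linarith

lemma cellIdx_zero {a len x : ℝ} (hlen : 0 < len) (hx : a ≤ x) (hx' : x < a + len) :
    cellIdx a len 0 x = 0 := by
  simpa using cellIdx_lt hlen hx hx' 0

/-! ### Bounds for alternating sums by the Vitali variation -/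

lemma boxVol_nonneg {ι : Type} [Fintype ι] {x y : ι → ℝ} (h : ∀ i, x i ≤ y i) : 0 ≤ boxVol x y :=
  Finset.prod_nonneg fun i _ => sub_nonneg.2 (h i)

section Vitali

variable {ι : Type} [Fintype ι] [DecidableEq ι]

/-- The defining inequality of the variation for a partition given by a finite family of boxes some
of which may be empty. -/
lemma sum_le_sq_of_vitaliVar_le {Λ : Type} [Fintype Λ] {α V : ℝ} (hV : 0 ≤ V) {a c : ι → ℝ}
    {g : (ι → ℝ) → ℝ} (hg : vitaliVar α a c g ≤ ENNReal.ofReal V) (A B : Λ → ι → ℝ)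
    (hAB : ∀ l i, A l i ≤ B l i) (hdisj : Pairwise fun l l' => Disjoint (box (A l) (B l))
      (box (A l') (B l'))) (hunion : ⋃ l, box (A l) (B l) = box a c) :
    ∑ l, boxVol (A l) (B l) * |altSum g (A l) (B l) / boxVol (A l) (B l) ^ α| ^ 2 ≤ V ^ 2 := by
  classical
  set F : (ι → ℝ) × (ι → ℝ) → ℝ :=
    fun I => boxVol I.1 I.2 * |altSum g I.1 I.2 / boxVol I.1 I.2 ^ α| ^ 2 with hF
  set Λ' : Finset Λ := Finset.univ.filter fun l => ∀ i, A l i < B l i with hΛ'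
  have hdeg : ∀ l ∉ Λ', ∃ i, A l i = B l i := by
    intro l hl
    simp only [hΛ', Finset.mem_filter, Finset.mem_univ, true_and, not_forall, not_lt] at hl
    obtain ⟨i, hi⟩ := hl
    exact ⟨i, le_antisymm (hAB l i) hi⟩
  have hne : ∀ l ∈ Λ', (box (A l) (B l)).Nonempty := by
    intro l hl
    refine ⟨A l, fun i _ => ⟨le_rfl, ?_⟩⟩
    exact (Finset.mem_filter.1 hl).2 i
  have hinj : Set.InjOn (fun l => (A l, B l)) (Λ' : Set Λ) := by
    intro l hl l' _ h
    by_contra hll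
    have h1 : Disjoint (box (A l) (B l)) (box (A l') (B l')) := hdisj hll
    simp only [Prod.mk.injEq] at h
    rw [← h.1, ← h.2] at h1
    exact (hne l hl).ne_empty (disjoint_self.1 h1)
  set P := Λ'.image fun l => (A l, B l) with hP
  have hpart : IsBoxPartition a c P := by
    refine ⟨?_, ?_, ?_⟩
    · intro I hI i
      obtain ⟨l, hl, rfl⟩ := Finset.mem_image.1 hI
      exact (Finset.mem_filter.1 hl).2 i
    · intro I hI J hJ hIJ
      obtain ⟨l, hl, rfl⟩ := Finset.mem_image.1 (Finset.mem_coe.1 hI)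
      obtain ⟨l', hl', rfl⟩ := Finset.mem_image.1 (Finset.mem_coe.1 hJ)
      exact hdisj fun h => hIJ (by rw [h])
    · rw [← hunion]
      ext x
      simp only [Set.mem_iUnion]
      constructor
      · rintro ⟨I, hI, hx⟩
        obtain ⟨l, hl, rfl⟩ := Finset.mem_image.1 hI
        exact ⟨l, hx⟩
      · rintro ⟨l, hx⟩
        refine ⟨_, Finset.mem_image_of_mem _ ?_, hx⟩
        simp only [hΛ', Finset.mem_filter, Finset.mem_univ, true_and]
        intro i
        have := hx i (Set.mem_univ i)
        exact this.1.trans_lt this.2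
  have hFnn : ∀ I ∈ P, 0 ≤ F I := by
    intro I hI
    exact mul_nonneg (boxVol_nonneg fun i => (hpart.1 I hI i).le) (by positivity)
  have h1 : ∑ l, boxVol (A l) (B l) * |altSum g (A l) (B l) / boxVol (A l) (B l) ^ α| ^ 2
      = ∑ I ∈ P, F I := by
    rw [hP, Finset.sum_image hinj]
    refine (Finset.sum_subset (Finset.subset_univ Λ') fun l _ hl => ?_).symm
    obtain ⟨i, hi⟩ := hdeg l hl
    rw [altSum_eq_zero g _ _ i hi]
    simp
  rw [h1]
  have h2 : (∑ I ∈ P, ENNReal.ofReal (F I)) ^ (1 / 2 : ℝ) ≤ ENNReal.ofReal V :=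
    le_trans (le_iSup₂ (f := fun P (_ : IsBoxPartition a c P) =>
      (∑ I ∈ P, ENNReal.ofReal (F I)) ^ (1 / 2 : ℝ)) P hpart) hg
  rw [← ENNReal.ofReal_sum_of_nonneg hFnn, one_div, ENNReal.rpow_inv_le_iff (by norm_num)] at h2
  have h3 : ENNReal.ofReal V ^ (2 : ℝ) = ENNReal.ofReal (V ^ 2) := by
    rw [ENNReal.ofReal_rpow_of_nonneg hV (by norm_num), Real.rpow_two]
  rw [h3] at h2
  exact (ENNReal.ofReal_le_ofReal_iff (by positivity)).1 h2

/-- If every dyadic cell of levels `ρ` of a box is given a sub-box, then the alternating sums over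
these sub-boxes are square summable: each cell splits into the sub-box and at most `3 ^ d - 1`
further boxes, which turns the family into a partition. -/
lemma sum_sq_altSum_le {α V : ℝ} (hα : 1 / 2 ≤ α) (hV : 0 ≤ V) {a len : ι → ℝ}
    (hlen : ∀ i, 0 < len i) {g : (ι → ℝ) → ℝ}
    (hg : vitaliVar α a (fun i => a i + len i) g ≤ ENNReal.ofReal V) (ρ : ι → ℕ)
    (p q : (∀ i, Fin (2 ^ ρ i)) → ι → ℝ)
    (hp : ∀ k i, cellLo (a i) (len i) (ρ i) (k i) ≤ p k i) (hpq : ∀ k i, p k i ≤ q k i)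
    (hq : ∀ k i, q k i ≤ cellLo (a i) (len i) (ρ i) (k i + 1)) :
    ∑ k, |altSum g (p k) (q k)| ^ 2
      ≤ ((∏ i, len i) * (2 ^ ∑ i, ρ i)⁻¹) ^ (2 * α - 1) * V ^ 2 := by
  classical
  set W := (∏ i, len i) * (2 ^ ∑ i, ρ i)⁻¹ with hW
  have hW0 : 0 < W := mul_pos (Finset.prod_pos fun i _ => hlen i) (by positivity)
  -- in each coordinate, a cell splits into the parts before, inside and after `[p, q)`
  set A : (∀ i, Fin (2 ^ ρ i)) × (ι → Fin 3) → ι → ℝ := fun l i =>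
    ![cellLo (a i) (len i) (ρ i) (l.1 i), p l.1 i, q l.1 i] (l.2 i) with hA
  set B : (∀ i, Fin (2 ^ ρ i)) × (ι → Fin 3) → ι → ℝ := fun l i =>
    ![p l.1 i, q l.1 i, cellLo (a i) (len i) (ρ i) (l.1 i + 1)] (l.2 i) with hB
  have hAB : ∀ l i, A l i ≤ B l i := by
    intro l i
    have h1 := hp l.1 i
    have h2 := hpq l.1 i
    have h3 := hq l.1 i
    simp only [hA, hB]
    generalize l.2 i = σ
    fin_cases σ <;> simpa
  have hcell : ∀ l i x, x ∈ Ico (A l i) (B l i) →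
      x ∈ Ico (cellLo (a i) (len i) (ρ i) (l.1 i)) (cellLo (a i) (len i) (ρ i) (l.1 i + 1)) := by
    intro l i x
    have h1 := hp l.1 i
    have h2 := hpq l.1 i
    have h3 := hq l.1 i
    simp only [hA, hB]
    generalize l.2 i = σ
    fin_cases σ <;> simp <;> intro h4 h5 <;> constructor <;> linarith
  have hge : ∀ l i x, x ∈ Ico (A l i) (B l i) → a i ≤ x := by
    intro l i x hx
    have h1 := (hcell l i x hx).1
    have h2 := cellLo_mono (a := a i) (hlen i) (ρ i) (Nat.zero_le (l.1 i))
    rw [cellLo_zero] at h2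
    linarith
  have hlt : ∀ l i x, x ∈ Ico (A l i) (B l i) → x < a i + len i := by
    intro l i x hx
    have h1 := (hcell l i x hx).2
    have h2 := cellLo_mono (a := a i) (hlen i) (ρ i) (l.1 i).isLt
    rw [cellLo_two_pow] at h2
    exact h1.trans_le h2
  have hdisj : Pairwise fun l l' => Disjoint (box (A l) (B l)) (box (A l') (B l')) := by
    intro l l' hll
    rw [Set.disjoint_left]
    intro x hx hx'
    have hk : l.1 = l'.1 := by
      funext i
      have h1 := hx i (Set.mem_univ i)
      have h2 := hx' i (Set.mem_univ i)
      have h3 := (mem_Ico_cellLo_iff (hlen i) (hge _ _ _ h1) _ _).1 (hcell l i _ h1)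
      have h4 := (mem_Ico_cellLo_iff (hlen i) (hge _ _ _ h1) _ _).1 (hcell l' i _ h2)
      exact Fin.ext (h3.symm.trans h4)
    refine hll (Prod.ext hk ?_)
    · funext i
      have h1 := hx i (Set.mem_univ i)
      have h2 := hx' i (Set.mem_univ i)
      have h5 := hpq l'.1 i
      simp only [hA, hB, hk] at h1 h2
      generalize l.2 i = σ at h1 ⊢
      generalize l'.2 i = τ at h2 ⊢
      fin_cases σ <;> fin_cases τ <;> simp at h1 h2 ⊢ <;> linarith [h1.1, h1.2, h2.1, h2.2]
  have hunion : ⋃ l, box (A l) (B l) = box a (fun i => a i + len i) := by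
    ext x
    simp only [Set.mem_iUnion]
    constructor
    · rintro ⟨l, hx⟩ i _
      exact ⟨hge l i _ (hx i (Set.mem_univ i)), hlt l i _ (hx i (Set.mem_univ i))⟩
    · intro hx
      have h1 : ∀ i, a i ≤ x i := fun i => (hx i (Set.mem_univ i)).1
      have h2 : ∀ i, x i < a i + len i := fun i => (hx i (Set.mem_univ i)).2
      set k : ∀ i, Fin (2 ^ ρ i) := fun i =>
        ⟨cellIdx (a i) (len i) (ρ i) (x i), cellIdx_lt (hlen i) (h1 i) (h2 i) _⟩ with hk
      refine ⟨(k, fun i => if x i < p k i then 0 else if x i < q k i then 1 else 2), ?_⟩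
      intro i _
      have h3 := (mem_Ico_cellLo_iff (hlen i) (h1 i) (ρ i) (k i)).2 rfl
      simp only [hA, hB]
      split_ifs with h4 h5
      · exact ⟨h3.1, h4⟩
      · exact ⟨not_lt.1 h4, h5⟩
      · exact ⟨not_lt.1 h5, h3.2⟩
  have hmain := sum_le_sq_of_vitaliVar_le hV hg A B hAB hdisj hunion
  set F : (∀ i, Fin (2 ^ ρ i)) × (ι → Fin 3) → ℝ :=
    fun l => boxVol (A l) (B l) * |altSum g (A l) (B l) / boxVol (A l) (B l) ^ α| ^ 2 with hF
  have hF0 : ∀ l, 0 ≤ F l := fun l => mul_nonneg (boxVol_nonneg (hAB l)) (by positivity)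
  have hsel : ∑ k, F (k, fun _ => 1) ≤ ∑ l, F l := by
    rw [Fintype.sum_prod_type]
    exact Finset.sum_le_sum fun k _ =>
      Finset.single_le_sum (f := fun σ => F (k, σ)) (fun σ _ => hF0 _) (Finset.mem_univ _)
  have hterm : ∀ k, |altSum g (p k) (q k)| ^ 2 ≤ W ^ (2 * α - 1) * F (k, fun _ => 1) := by
    intro k
    have hFk : F (k, fun _ => 1)
        = boxVol (p k) (q k) * |altSum g (p k) (q k) / boxVol (p k) (q k) ^ α| ^ 2 := rfl
    rw [hFk]
    by_cases hz : ∃ i, p k i = q k i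
    · obtain ⟨i, hi⟩ := hz
      rw [altSum_eq_zero g _ _ i hi]
      simp
    · push Not at hz
      set v := boxVol (p k) (q k) with hv
      have hv0 : 0 < v := Finset.prod_pos fun i _ =>
        sub_pos.2 (lt_of_le_of_ne (hpq k i) (hz i))
      have hvW : v ≤ W := by
        have h1 : W = ∏ i, len i * (2 ^ ρ i)⁻¹ := by
          rw [hW, Finset.prod_mul_distrib, Finset.prod_inv_distrib, Finset.prod_pow_eq_pow_sum]
        rw [h1]
        refine Finset.prod_le_prod (fun i _ => sub_nonneg.2 (hpq k i)) fun i _ => ?_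
        have h2 := hp k i
        have h3 := hq k i
        have h4 : cellLo (a i) (len i) (ρ i) (k i + 1) - cellLo (a i) (len i) (ρ i) (k i)
            = len i * (2 ^ ρ i)⁻¹ := by
          simp only [cellLo]; push_cast; ring
        linarith
      have h5 : |altSum g (p k) (q k)| ^ 2
          = v ^ (2 * α - 1) * (v * |altSum g (p k) (q k) / v ^ α| ^ 2) := by
        rw [abs_div, div_pow, abs_of_pos (Real.rpow_pos_of_pos hv0 α), ← Real.rpow_natCast (v ^ α),
          ← Real.rpow_mul hv0.le, ← mul_assoc, ← Real.rpow_add_one hv0.ne',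
          show 2 * α - 1 + 1 = α * ((2 : ℕ) : ℝ) by push_cast; ring]
        have := (Real.rpow_pos_of_pos hv0 (α * ((2 : ℕ) : ℝ))).ne'
        field_simp
      rw [h5]
      refine mul_le_mul_of_nonneg_right ?_ (by positivity)
      exact Real.rpow_le_rpow hv0.le hvW (by linarith)
  calc ∑ k, |altSum g (p k) (q k)| ^ 2 ≤ ∑ k, W ^ (2 * α - 1) * F (k, fun _ => 1) :=
        Finset.sum_le_sum fun k _ => hterm k
    _ = W ^ (2 * α - 1) * ∑ k, F (k, fun _ => 1) := by rw [Finset.mul_sum]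
    _ ≤ W ^ (2 * α - 1) * V ^ 2 := by
        refine mul_le_mul_of_nonneg_left (hsel.trans hmain) (by positivity)

/-- If equally many nodes lie in each dyadic cell of levels `ρ`, and to each node belongs a box in
its cell, then the mean of the alternating sums over these boxes is bounded by the variation. -/
lemma sum_abs_altSum_le {α V : ℝ} (hα : 1 / 2 ≤ α) (hV : 0 ≤ V) {a len : ι → ℝ}
    (hlen : ∀ i, 0 < len i) {g : (ι → ℝ) → ℝ}
    (hg : vitaliVar α a (fun i => a i + len i) g ≤ ENNReal.ofReal V) (ρ : ι → ℕ)
    (T : Finset ℕ) (κ : ℕ → ∀ i, Fin (2 ^ ρ i))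
    (hcount : ∀ k, (T.filter fun n => κ n = k).card * 2 ^ ∑ i, ρ i = T.card)
    (P Q : ℕ → ι → ℝ)
    (hP : ∀ n ∈ T, ∀ i, P n i ∈ Icc (cellLo (a i) (len i) (ρ i) (κ n i))
      (cellLo (a i) (len i) (ρ i) (κ n i + 1)))
    (hQ : ∀ n ∈ T, ∀ i, Q n i ∈ Icc (cellLo (a i) (len i) (ρ i) (κ n i))
      (cellLo (a i) (len i) (ρ i) (κ n i + 1))) :
    ∑ n ∈ T, |altSum g (P n) (Q n)|
      ≤ T.card * ((2 ^ (-α)) ^ (∑ i, ρ i) * ((∏ i, len i) ^ (α - 1 / 2) * V)) := by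
  classical
  rcases T.eq_empty_or_nonempty with rfl | hT
  · simp
  set m := ∑ i, ρ i with hm
  set D : ℕ → ℝ := fun n => |altSum g (P n) (Q n)| with hD
  have hfib : ∀ k, (T.filter fun n => κ n = k).Nonempty := by
    intro k
    rw [← Finset.card_pos]
    by_contra h
    have h1 := hcount k
    have h2 := hT.card_pos
    rw [Nat.eq_zero_of_not_pos h] at h1
    omega
  -- in every cell, a node with the largest alternating sum
  have hmax : ∀ k, ∃ n ∈ T.filter (fun n => κ n = k), ∀ n' ∈ T.filter (fun n => κ n = k),
      D n' ≤ D n := fun k => Finset.exists_max_image _ D (hfib k)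
  choose w hw hwmax using hmax
  have hwT : ∀ k, w k ∈ T := fun k => (Finset.mem_filter.1 (hw k)).1
  have hwκ : ∀ k, κ (w k) = k := fun k => (Finset.mem_filter.1 (hw k)).2
  have hsq := sum_sq_altSum_le hα hV hlen hg ρ (fun k => P (w k) ⊓ Q (w k))
    (fun k => P (w k) ⊔ Q (w k))
    (fun k i => by
      have h1 := (hP _ (hwT k) i).1
      have h2 := (hQ _ (hwT k) i).1
      rw [hwκ] at h1 h2
      exact le_inf h1 h2)
    (fun k i => inf_le_sup)
    (fun k i => by
      have h1 := (hP _ (hwT k) i).2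
      have h2 := (hQ _ (hwT k) i).2
      rw [hwκ] at h1 h2
      exact sup_le h1 h2)
  simp only [abs_altSum_inf_sup] at hsq
  set W := (∏ i, len i) with hW
  have hW0 : 0 < W := Finset.prod_pos fun i _ => hlen i
  have hcardK : (Finset.univ : Finset (∀ i, Fin (2 ^ ρ i))).card = 2 ^ m := by
    rw [Finset.card_univ, Fintype.card_pi]
    simp [Finset.prod_pow_eq_pow_sum, hm]
  have h1 : ∑ n ∈ T, D n ≤ ∑ k, (T.card * (2 ^ m)⁻¹ : ℝ) * D (w k) := by
    rw [← Finset.sum_fiberwise T κ D]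
    refine Finset.sum_le_sum fun k _ => ?_
    have h2 : ∑ n ∈ T.filter (fun n => κ n = k), D n
        ≤ (T.filter (fun n => κ n = k)).card • D (w k) :=
      Finset.sum_le_card_nsmul _ _ _ (hwmax k)
    refine h2.trans (le_of_eq ?_)
    rw [nsmul_eq_mul]
    congr 1
    have h3 : ((T.filter fun n => κ n = k).card : ℝ) * 2 ^ m = T.card := by
      exact_mod_cast hcount k
    rw [← h3]; field_simp
  rw [← Finset.mul_sum] at h1
  refine h1.trans ?_
  rw [mul_assoc]
  refine mul_le_mul_of_nonneg_left ?_ (by positivity)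
  -- there are `2 ^ m` cells
  have h4 : (∑ k, D (w k)) ^ 2 ≤ 2 ^ m * ((W * (2 ^ m)⁻¹) ^ (2 * α - 1) * V ^ 2) := by
    have h5 := sq_sum_le_card_mul_sum_sq (s := Finset.univ) (f := fun k => D (w k))
    rw [hcardK] at h5
    refine h5.trans ?_
    push_cast
    exact mul_le_mul_of_nonneg_left hsq (by positivity)
  have h2m : ((2 : ℝ) ^ (-α)) ^ m = ((2 : ℝ) ^ m) ^ (-α) := by
    rw [← Real.rpow_natCast, ← Real.rpow_natCast, ← Real.rpow_mul (by norm_num),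
      ← Real.rpow_mul (by norm_num), mul_comm]
  rw [h2m]
  set N : ℝ := 2 ^ m with hN
  have hN0 : 0 < N := by positivity
  refine abs_le_of_sq_le_sq' ?_ (by positivity) |>.2
  rw [mul_pow]
  calc N⁻¹ ^ 2 * (∑ k, D (w k)) ^ 2
      ≤ N⁻¹ ^ 2 * (N * ((W * N⁻¹) ^ (2 * α - 1) * V ^ 2)) := by gcongr
    _ = (N ^ (-α) * (W ^ (α - 1 / 2) * V)) ^ 2 := by
        have e1 : (N ^ (-α)) ^ 2 = N⁻¹ * (N⁻¹) ^ (2 * α - 1) := by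
          rw [← Real.rpow_natCast, ← Real.rpow_mul hN0.le, Real.inv_rpow hN0.le,
            ← Real.rpow_neg hN0.le, ← Real.rpow_neg_one N, ← Real.rpow_add hN0]
          congr 1; push_cast; ring
        have e2 : (W ^ (α - 1 / 2)) ^ 2 = W ^ (2 * α - 1) := by
          rw [← Real.rpow_natCast, ← Real.rpow_mul hW0.le]
          congr 1; push_cast; ring
        rw [mul_pow, mul_pow, e1, e2, Real.mul_rpow hW0.le (by positivity)]
        field_simp

end Vitali

/-! ### Multilinear extension of a function of levels -/

/-- The multilinear form on `(ℕ → ℝ) ^ ι` whose value at the unit vectors `e_{r i}` is `φ r`,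
provided that all `r i` are at most `M + 1`. -/
def levelExtension {ι : Type} [Fintype ι] [DecidableEq ι] (M : ℕ) (φ : (ι → ℕ) → ℝ) :
    MultilinearMap ℝ (fun _ : ι => ℕ → ℝ) ℝ :=
  ∑ r ∈ Fintype.piFinset fun _ : ι => Finset.range (M + 2),
    φ r • (MultilinearMap.mkPiAlgebra ℝ ι ℝ).compLinearMap fun i => LinearMap.proj (r i)

lemma levelExtension_single {ι : Type} [Fintype ι] [DecidableEq ι] (M : ℕ) (φ : (ι → ℕ) → ℝ)
    (r : ι → ℕ) (hr : ∀ i, r i ≤ M + 1) :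
    levelExtension M φ (fun i => Pi.single (r i) 1) = φ r := by
  rw [levelExtension, sum_apply, Finset.sum_eq_single r]
  · simp
  · intro r' _ hne
    obtain ⟨i, hi⟩ := Function.ne_iff.1 hne
    simp only [smul_apply, MultilinearMap.compLinearMap_apply,
      MultilinearMap.mkPiAlgebra_apply, smul_eq_mul, LinearMap.proj_apply]
    rw [Finset.prod_eq_zero (Finset.mem_univ i), mul_zero]
    simp [hi]
  · intro h
    exact absurd (Fintype.mem_piFinset.2 fun i => Finset.mem_range.2 (by have := hr i; omega)) h

lemma map_piecewise_sub {ι : Type} [DecidableEq ι] {E : Type} [AddCommGroup E] [Module ℝ E]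
    (Φ : MultilinearMap ℝ (fun _ : ι => E) ℝ) (A B Z : ι → E) (u : Finset ι) :
    Φ (u.piecewise (fun i => A i - B i) Z)
      = ∑ v ∈ u.powerset, (-1) ^ v.card * Φ (v.piecewise B (u.piecewise A Z)) := by
  have h1 : u.piecewise (fun i => A i - B i) Z
      = u.piecewise ((fun i => (-1 : ℝ) • B i) + u.piecewise A Z) (u.piecewise A Z) := by
    ext i
    by_cases hi : i ∈ u
    · simp [hi]; abel
    · simp [hi]
  rw [h1, MultilinearMap.map_piecewise_add]
  refine Finset.sum_congr rfl fun v _ => ?_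
  have h2 : v.piecewise (fun i => (-1 : ℝ) • B i) (u.piecewise A Z)
      = v.piecewise (fun i => (-1 : ℝ) • v.piecewise B (u.piecewise A Z) i)
        (v.piecewise B (u.piecewise A Z)) := by
    ext i
    by_cases hi : i ∈ v <;> simp [hi]
  rw [h2, MultilinearMap.map_piecewise_smul]
  simp

/-! ### Integration over boxes -/

lemma measurableSet_box {ι : Type} [Fintype ι] (x y : ι → ℝ) : MeasurableSet (box x y) :=
  MeasurableSet.univ_pi fun _ => measurableSet_Ico

lemma box_subset_Icc {ι : Type} (x y : ι → ℝ) : box x y ⊆ Icc x y := fun _ hz =>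
  ⟨fun i => (hz i (Set.mem_univ i)).1, fun i => (hz i (Set.mem_univ i)).2.le⟩

lemma mem_box {ι : Type} {x y z : ι → ℝ} : z ∈ box x y ↔ ∀ i, z i ∈ Ico (x i) (y i) := by
  simp [box]

lemma volume_box {ι : Type} [Fintype ι] {x y : ι → ℝ} :
    volume (box x y) = ∏ i, ENNReal.ofReal (y i - x i) := by
  rw [box, Real.volume_pi_Ico]

lemma volume_box_lt_top {ι : Type} [Fintype ι] (x y : ι → ℝ) : volume (box x y) < ∞ := by
  rw [volume_box]
  exact ENNReal.prod_lt_top fun i _ => ENNReal.ofReal_lt_top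

lemma volume_real_box {ι : Type} [Fintype ι] {x y : ι → ℝ} (h : ∀ i, x i ≤ y i) :
    volume.real (box x y) = boxVol x y := by
  rw [measureReal_def, volume_box, boxVol, ENNReal.toReal_prod]
  exact Finset.prod_congr rfl fun i _ => ENNReal.toReal_ofReal (sub_nonneg.2 (h i))

lemma integrableOn_box {ι : Type} [Fintype ι] {f : (ι → ℝ) → ℝ} (hf : Continuous f) (x y : ι → ℝ) :
    IntegrableOn f (box x y) :=
  (hf.continuousOn.integrableOn_compact isCompact_Icc).mono_set (box_subset_Icc x y)

/-- The change of variables that maps the box `∏ [a i, a i + len i)` to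
`∏ [c i, c i + len i * t i)`. -/
lemma setIntegral_box_comp_affine {ι : Type} [Fintype ι] [DecidableEq ι] {f : (ι → ℝ) → ℝ}
    (hf : Continuous f)
    (a len c t : ι → ℝ) (ht : ∀ i, 0 < t i) :
    (∏ i, t i) * ∫ y in box a (fun i => a i + len i), f (fun i => c i + (y i - a i) * t i)
      = ∫ y in box c (fun i => c i + len i * t i), f y := by
  set cell := box c (fun i => c i + len i * t i) with hcell
  -- the affine map is multiplication by `t` followed by translation by `w`
  set w : ι → ℝ := fun i => c i - t i * a i with hw
  have hdet : (Matrix.diagonal t).det = ∏ i, t i := Matrix.det_diagonal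
  have hpos : 0 < ∏ i, t i := Finset.prod_pos fun i _ => ht i
  set H : (ι → ℝ) → ℝ := fun z => cell.indicator f (z + w) with hH
  have hHm : Measurable H :=
    (hf.measurable.indicator (measurableSet_box _ _)).comp (measurable_id.add_const w)
  have h1 : ∫ z, H z = ∫ y in cell, f y := by
    rw [← integral_indicator (measurableSet_box _ _)]
    exact integral_add_right_eq_self (fun z => cell.indicator f z) w
  have h2 : ∫ z, H z = (∏ i, t i) * ∫ y : ι → ℝ, H (fun i => t i * y i) := by
    have h3 := Real.smul_map_diagonal_volume_pi (D := t) (by rw [hdet]; exact hpos.ne')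
    have hlin : ∀ y : ι → ℝ, Matrix.toLin' (Matrix.diagonal t) y = fun i => t i * y i := by
      intro y; ext i; simp [Matrix.mulVec_diagonal]
    rw [hdet, abs_of_pos hpos] at h3
    conv_lhs => rw [← h3]
    rw [integral_smul_measure, ENNReal.toReal_ofReal hpos.le, smul_eq_mul, integral_map]
    · simp only [hlin]
    · exact (LinearMap.continuous_of_finiteDimensional _).aemeasurable
    · exact hHm.aestronglyMeasurable
  rw [← h1, h2, ← integral_indicator (measurableSet_box _ _)]
  congr 2
  ext y
  have harg : ((fun i => t i * y i) + w) = fun i => c i + (y i - a i) * t i := by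
    ext i; simp only [hw, Pi.add_apply]; ring
  have hmem : (fun i => c i + (y i - a i) * t i) ∈ cell ↔ y ∈ box a (fun i => a i + len i) := by
    rw [hcell, mem_box, mem_box]
    refine forall_congr' fun i => ?_
    simp only [mem_Ico]
    refine and_congr ?_ ?_
    · rw [le_add_iff_nonneg_right, mul_nonneg_iff_of_pos_right (ht i), sub_nonneg]
    · rw [add_lt_add_iff_left, mul_lt_mul_iff_left₀ (ht i), sub_lt_iff_lt_add']
  simp only [hH, harg]
  by_cases hy : y ∈ box a (fun i => a i + len i)
  · rw [Set.indicator_of_mem hy, Set.indicator_of_mem (hmem.2 hy)]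
  · rw [Set.indicator_of_notMem hy, Set.indicator_of_notMem (fun h => hy (hmem.1 h))]

/-- The dyadic cells of given levels decompose the integral over a box. -/
lemma sum_setIntegral_cell {ι : Type} [Fintype ι] [DecidableEq ι] {f : (ι → ℝ) → ℝ}
    (hf : Continuous f) (a len : ι → ℝ)
    (hlen : ∀ i, 0 < len i) (r : ι → ℕ) :
    ∑ k : ∀ i, Fin (2 ^ r i), ∫ y in box (fun i => cellLo (a i) (len i) (r i) (k i))
        (fun i => cellLo (a i) (len i) (r i) (k i + 1)), f y
      = ∫ y in box a (fun i => a i + len i), f y := by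
  have hge : ∀ (k : ∀ i, Fin (2 ^ r i)) i x, x ∈ Ico (cellLo (a i) (len i) (r i) (k i))
      (cellLo (a i) (len i) (r i) (k i + 1)) → a i ≤ x := by
    intro k i x hx
    have h2 := cellLo_mono (a := a i) (hlen i) (r i) (Nat.zero_le (k i))
    rw [cellLo_zero] at h2
    exact h2.trans hx.1
  rw [← integral_iUnion_fintype]
  · congr 2
    ext x
    simp only [Set.mem_iUnion, mem_box]
    constructor
    · rintro ⟨k, hk⟩ i
      refine ⟨hge k i _ (hk i), (hk i).2.trans_le ?_⟩
      rw [← cellLo_two_pow (a i) (len i) (r i)]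
      exact cellLo_mono (hlen i) (r i) (k i).isLt
    · intro hx
      exact ⟨fun i => ⟨cellIdx (a i) (len i) (r i) (x i), cellIdx_lt (hlen i) (hx i).1 (hx i).2 _⟩,
        fun i => (mem_Ico_cellLo_iff (hlen i) (hx i).1 (r i) _).2 rfl⟩
  · exact fun k => measurableSet_box _ _
  · intro k k' hkk
    rw [Function.onFun, Set.disjoint_left]
    intro x hx hx'
    rw [mem_box] at hx hx'
    refine hkk (funext fun i => Fin.ext ?_)
    exact ((mem_Ico_cellLo_iff (hlen i) (hge k i _ (hx i)) _ _).1 (hx i)).symm.trans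
      ((mem_Ico_cellLo_iff (hlen i) (hge k i _ (hx i)) _ _).1 (hx' i))
  · exact fun k => integrableOn_box hf _ _

lemma measurePreserving_merge {s : ℕ} (u : Finset (Fin s)) :
    MeasurePreserving (fun z : ({i // i ∈ u} → ℝ) × ({i // i ∉ u} → ℝ) => merge u z.1 z.2) := by
  have h := (volume_preserving_piEquivPiSubtypeProd (fun _ : Fin s => ℝ) (fun i => i ∈ u)).symm
  -- the two sides differ in the proof that `{i // i ∈ u}` is finite
  convert h
  rfl

lemma continuous_merge {s : ℕ} (u : Finset (Fin s)) :
    Continuous (fun z : ({i // i ∈ u} → ℝ) × ({i // i ∉ u} → ℝ) => merge u z.1 z.2) := by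
  refine continuous_pi fun i => ?_
  unfold merge
  split_ifs <;> fun_prop

lemma integrableOn_merge {s : ℕ} (u : Finset (Fin s)) {F : (Fin s → ℝ) → ℝ} (hF : Continuous F)
    (a c : Fin s → ℝ) :
    IntegrableOn (fun z : ({i // i ∈ u} → ℝ) × ({i // i ∉ u} → ℝ) => F (merge u z.1 z.2))
      (box (fun i : {i // i ∈ u} => a i) (fun i => c i)
        ×ˢ box (fun i : {i // i ∉ u} => a i) (fun i => c i)) (volume.prod volume) := by
  refine ((hF.comp (continuous_merge u)).continuousOn.integrableOn_compact
    (isCompact_Icc.prod isCompact_Icc)).mono_set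
      (Set.prod_mono (box_subset_Icc _ _) (box_subset_Icc _ _))

lemma setIntegral_box_merge {s : ℕ} (u : Finset (Fin s)) {F : (Fin s → ℝ) → ℝ}
    (hF : Continuous F) (a c : Fin s → ℝ) :
    ∫ y in box a c, F y = ∫ y₁ in box (fun i : {i // i ∈ u} => a i) (fun i => c i),
      ∫ y₂ in box (fun i : {i // i ∉ u} => a i) (fun i => c i), F (merge u y₁ y₂) := by
  have hmp := measurePreserving_merge u
  have hemb : MeasurableEmbedding
      (fun z : ({i // i ∈ u} → ℝ) × ({i // i ∉ u} → ℝ) => merge u z.1 z.2) :=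
    (MeasurableEquiv.piEquivPiSubtypeProd (fun _ : Fin s => ℝ)
      (fun i => i ∈ u)).symm.measurableEmbedding
  rw [← hmp.setIntegral_preimage_emb hemb, ← setIntegral_prod _ (integrableOn_merge u hF a c)]
  congr 2
  ext z
  simp only [Set.mem_preimage, Set.mem_prod, mem_box]
  constructor
  · intro h
    refine ⟨fun i => ?_, fun i => ?_⟩
    · have := h i
      simpa [merge, i.2] using this
    · have := h i
      simpa [merge, i.2] using this
  · rintro ⟨h1, h2⟩ i
    by_cases hi : i ∈ u
    · simpa [merge, hi] using h1 ⟨i, hi⟩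
    · simpa [merge, hi] using h2 ⟨i, hi⟩

lemma integrableOn_integral_merge {s : ℕ} (u : Finset (Fin s)) {F : (Fin s → ℝ) → ℝ}
    (hF : Continuous F) (a c : Fin s → ℝ) :
    IntegrableOn (fun y₁ => ∫ y₂ in box (fun i : {i // i ∉ u} => a i) (fun i => c i),
      F (merge u y₁ y₂)) (box (fun i : {i // i ∈ u} => a i) (fun i => c i)) := by
  have h := integrableOn_merge u hF a c
  rw [IntegrableOn, ← Measure.prod_restrict] at h
  exact h.integral_prod_left

/-! ### The integration error in a single box -/

/-- The point of `[a, a + len)` that sees `x` only at the resolution of level `r`: for `r ≤ M` it is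
the point of the cell of `x` of level `r` that corresponds to `y` under the affine map from
`[a, a + len)` onto this cell. Levels above `M` stand for full resolution. -/
def resolve (M : ℕ) (a len : ℝ) (r : ℕ) (x y : ℝ) : ℝ :=
  if r ≤ M then cellLo a len r (cellIdx a len r x) + (y - a) * (2 ^ r)⁻¹ else x

lemma resolve_zero {M : ℕ} {a len x y : ℝ} (hlen : 0 < len) (hx : x ∈ Ico a (a + len)) :
    resolve M a len 0 x y = y := by
  simp [resolve, cellIdx_zero hlen hx.1 hx.2, cellLo_zero]

lemma continuous_resolve (M : ℕ) (a len : ℝ) (r : ℕ) (x : ℝ) :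
    Continuous (resolve M a len r x) := by
  unfold resolve
  split_ifs <;> fun_prop

lemma cellIdx_div {a len : ℝ} {ρ r : ℕ} (h : ρ ≤ r) (x : ℝ) :
    cellIdx a len ρ x = cellIdx a len r x / 2 ^ (r - ρ) := by
  unfold cellIdx
  have h1 : (2 : ℝ) ^ r = 2 ^ ρ * 2 ^ (r - ρ) := by rw [← pow_add]; congr 1; omega
  have h2 : ((2 ^ (r - ρ) : ℕ) : ℝ) = 2 ^ (r - ρ) := by push_cast; rfl
  rw [← Nat.floor_div_natCast, h2, h1, ← mul_assoc, mul_div_assoc, div_self (by positivity),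
    mul_one]

lemma resolve_mem_cell {M : ℕ} {a len x y : ℝ} (hlen : 0 < len) (hx : x ∈ Ico a (a + len))
    (hy : y ∈ Ico a (a + len)) {ρ r : ℕ} (h : ρ ≤ r) :
    resolve M a len r x y ∈ Ico (cellLo a len ρ (cellIdx a len ρ x))
      (cellLo a len ρ (cellIdx a len ρ x + 1)) := by
  unfold resolve
  split_ifs with hr
  · set z := cellLo a len r (cellIdx a len r x) + (y - a) * (2 ^ r)⁻¹ with hz
    have h2 : (0 : ℝ) < (2 ^ r)⁻¹ := by positivity
    have hzr : z ∈ Ico (cellLo a len r (cellIdx a len r x))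
        (cellLo a len r (cellIdx a len r x + 1)) := by
      have h3 : cellLo a len r (cellIdx a len r x + 1)
          = cellLo a len r (cellIdx a len r x) + len * (2 ^ r)⁻¹ := by
        simp only [cellLo]; push_cast; ring
      rw [h3]
      refine ⟨?_, ?_⟩
      · have : 0 ≤ (y - a) * (2 ^ r)⁻¹ := mul_nonneg (sub_nonneg.2 hy.1) h2.le
        linarith
      · have : (y - a) * (2 ^ r)⁻¹ < len * (2 ^ r)⁻¹ :=
          mul_lt_mul_of_pos_right (by linarith [hy.2]) h2
        linarith
    have hza : a ≤ z := by
      have := cellLo_mono (a := a) hlen r (Nat.zero_le (cellIdx a len r x))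
      rw [cellLo_zero] at this
      exact this.trans hzr.1
    rw [mem_Ico_cellLo_iff hlen hza, cellIdx_div h, cellIdx_div h x,
      (mem_Ico_cellLo_iff hlen hza _ _).1 hzr]
  · exact (mem_Ico_cellLo_iff hlen hx.1 _ _).2 rfl

section Local

variable {s : ℕ} (p : BoxIdx s)

/-- The side lengths of the elementary interval `p` in base `2`. -/
def sideLen (i : Fin s) : ℝ := (2 : ℝ) ^ (p.1 i)

lemma sideLen_pos (i : Fin s) : 0 < sideLen p i := by unfold sideLen; positivity

lemma hi_eq (i : Fin s) : hi 2 p i = lo 2 p i + sideLen p i := by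
  simp only [hi, lo, sideLen]; push_cast; ring

lemma lo_le_hi (i : Fin s) : lo 2 p i ≤ hi 2 p i := by
  rw [hi_eq]; linarith [sideLen_pos p i]

lemma boxVol_eq_prod_sideLen : boxVol (lo 2 p) (hi 2 p) = ∏ i, sideLen p i := by
  unfold boxVol
  exact Finset.prod_congr rfl fun i _ => by rw [hi_eq]; ring

/-- The nodes `x n`, `n ∈ T`, are evenly distributed over the dyadic cells of the elementary
interval `p` whose levels have sum at most `M`. -/
def EvenlyDistributed (T : Finset ℕ) (x : ℕ → Fin s → ℝ) (M : ℕ) : Prop :=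
  ∀ ρ : Fin s → ℕ, ∑ i, ρ i ≤ M → ∀ k : Fin s → ℕ, (∀ i, k i < 2 ^ ρ i) →
    (T.filter fun n => ∀ i, cellIdx (lo 2 p i) (sideLen p i) (ρ i) (x n i) = k i).card
      * 2 ^ ∑ i, ρ i = T.card

variable {p} {T : Finset ℕ} {x : ℕ → Fin s → ℝ} {M : ℕ} {f : (Fin s → ℝ) → ℝ}

/-- The sum over the nodes of the integrals of `f`, where the node and the variable of integration
interact at the levels of resolution `r`. It interpolates between the sum of the values of `f` at
the nodes and the integral of `f`. -/
def levelSum (p : BoxIdx s) (T : Finset ℕ) (x : ℕ → Fin s → ℝ) (M : ℕ) (f : (Fin s → ℝ) → ℝ)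
    (r : Fin s → ℕ) : ℝ :=
  ∑ n ∈ T, ∫ y in box (lo 2 p) (hi 2 p),
    f fun i => resolve M (lo 2 p i) (sideLen p i) (r i) (x n i) (y i)

lemma levelSum_top :
    levelSum p T x M f (fun _ => M + 1) = boxVol (lo 2 p) (hi 2 p) * ∑ n ∈ T, f (x n) := by
  simp only [levelSum, resolve, Nat.not_succ_le_self, if_false, setIntegral_const, smul_eq_mul]
  rw [volume_real_box (lo_le_hi p), Finset.mul_sum]

/-- Up to level sum `M` the nodes integrate exactly, since they are evenly distributed. -/
lemma levelSum_eq (hf : Continuous f) (hx : ∀ n ∈ T, x n ∈ box (lo 2 p) (hi 2 p))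
    (hT : EvenlyDistributed p T x M) (r : Fin s → ℕ) (hr : ∑ i, r i ≤ M) :
    levelSum p T x M f r = T.card * ∫ y in box (lo 2 p) (hi 2 p), f y := by
  have hri : ∀ i, r i ≤ M := fun i =>
    (Finset.single_le_sum (f := r) (fun _ _ => Nat.zero_le _) (Finset.mem_univ i)).trans hr
  have hhi : hi 2 p = fun i => lo 2 p i + sideLen p i := funext (hi_eq p)
  have hxi : ∀ n ∈ T, ∀ i, x n i ∈ Ico (lo 2 p i) (lo 2 p i + sideLen p i) := by
    intro n hn i
    rw [← hi_eq]
    exact mem_box.1 (hx n hn) i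
  set I : (∀ i, Fin (2 ^ r i)) → ℝ := fun k =>
    ∫ y in box (fun i => cellLo (lo 2 p i) (sideLen p i) (r i) (k i))
        (fun i => cellLo (lo 2 p i) (sideLen p i) (r i) (k i + 1)), f y with hI
  set κ : ℕ → ∀ i, Fin (2 ^ r i) := fun n i =>
    Fin.ofNat (2 ^ r i) (cellIdx (lo 2 p i) (sideLen p i) (r i) (x n i)) with hκ
  have hκv : ∀ n ∈ T, ∀ i, (κ n i : ℕ) = cellIdx (lo 2 p i) (sideLen p i) (r i) (x n i) := by
    intro n hn i
    exact Nat.mod_eq_of_lt (cellIdx_lt (sideLen_pos p i) (hxi n hn i).1 (hxi n hn i).2 _)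
  have h1 : ∀ n ∈ T, ∫ y in box (lo 2 p) (hi 2 p),
      f (fun i => resolve M (lo 2 p i) (sideLen p i) (r i) (x n i) (y i))
        = 2 ^ (∑ i, r i) * I (κ n) := by
    intro n hn
    have h2 := setIntegral_box_comp_affine hf (lo 2 p) (sideLen p)
      (fun i => cellLo (lo 2 p i) (sideLen p i) (r i) (κ n i)) (fun i => (2 ^ r i)⁻¹)
      (fun i => by positivity)
    have h3 : (fun i => cellLo (lo 2 p i) (sideLen p i) (r i) (κ n i)
        + sideLen p i * (2 ^ r i)⁻¹)
        = fun i => cellLo (lo 2 p i) (sideLen p i) (r i) (κ n i + 1) := by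
      ext i; simp only [cellLo]; push_cast; ring
    rw [h3, Finset.prod_inv_distrib, Finset.prod_pow_eq_pow_sum] at h2
    rw [hI]
    dsimp only
    rw [← h2, mul_inv_cancel_left₀ (by positivity), hhi]
    congr 1
    ext y
    congr 1
    ext i
    rw [resolve, if_pos (hri i), hκv n hn]
  rw [levelSum, Finset.sum_congr rfl h1, ← Finset.sum_fiberwise T κ, hhi,
    ← sum_setIntegral_cell hf (lo 2 p) (sideLen p) (sideLen_pos p) r, Finset.mul_sum]
  refine Finset.sum_congr rfl fun k _ => ?_
  have h4 : ∑ n ∈ T.filter (fun n => κ n = k), 2 ^ (∑ i, r i) * I (κ n)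
      = ∑ n ∈ T.filter (fun n => κ n = k), 2 ^ (∑ i, r i) * I k :=
    Finset.sum_congr rfl fun n hn => by rw [(Finset.mem_filter.1 hn).2]
  have h5 : (T.filter fun n => κ n = k) = T.filter fun n => ∀ i,
      cellIdx (lo 2 p i) (sideLen p i) (r i) (x n i) = k i := by
    refine Finset.filter_congr fun n hn => ?_
    rw [funext_iff]
    exact forall_congr' fun i => by rw [Fin.ext_iff, hκv n hn]
  have h6 := hT r hr (fun i => k i) (fun i => (k i).isLt)
  rw [h4, Finset.sum_const, h5, nsmul_eq_mul, ← mul_assoc]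
  congr 1
  exact_mod_cast h6

/-- Integration over the coordinates outside `u`, where the resolution is zero, turns `f` into its
marginal. -/
lemma setIntegral_resolve_eq (hf : Continuous f) {n : ℕ} (hx : x n ∈ box (lo 2 p) (hi 2 p))
    (u : Finset (Fin s)) (r : Fin s → ℕ) (hr : ∀ i ∉ u, r i = 0) :
    ((∫ y in box (lo 2 p) (hi 2 p),
        f fun i => resolve M (lo 2 p i) (sideLen p i) (r i) (x n i) (y i))
      = ∫ y in box (fun i : {i // i ∈ u} => lo 2 p i) (fun i => hi 2 p i),
        marginal 2 p u f fun i => resolve M (lo 2 p i) (sideLen p i) (r i) (x n i) (y i)) ∧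
    IntegrableOn (fun y => marginal 2 p u f fun i : {i // i ∈ u} =>
        resolve M (lo 2 p i) (sideLen p i) (r i) (x n i) (y i))
      (box (fun i : {i // i ∈ u} => lo 2 p i) (fun i => hi 2 p i)) := by
  set F : (Fin s → ℝ) → ℝ := fun y =>
    f fun i => resolve M (lo 2 p i) (sideLen p i) (r i) (x n i) (y i) with hF
  have hFc : Continuous F := hf.comp (continuous_pi fun i =>
    (continuous_resolve M _ _ _ _).comp (continuous_apply i))
  have hmarg : ∀ y : {i // i ∈ u} → ℝ,
      (∫ y₂ in box (fun i : {i // i ∉ u} => lo 2 p i) (fun i => hi 2 p i), F (merge u y y₂))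
        = marginal 2 p u f fun i => resolve M (lo 2 p i) (sideLen p i) (r i) (x n i) (y i) := by
    intro y
    rw [marginal]
    congr 1
    ext y₂
    simp only [hF]
    congr 1
    ext i
    by_cases hi : i ∈ u
    · simp [merge, hi]
    · have := mem_box.1 hx i
      rw [hi_eq] at this
      simp [merge, hi, hr i hi, resolve_zero (sideLen_pos p i) this]
  have h1 := setIntegral_box_merge u hFc (lo 2 p) (hi 2 p)
  have h2 := integrableOn_integral_merge u hFc (lo 2 p) (hi 2 p)
  simp only [hmarg] at h1 h2
  exact ⟨h1, h2⟩

lemma sum_powerset_eq_sum_subtype (u : Finset (Fin s)) (F : Finset (Fin s) → ℝ) :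
    ∑ v ∈ u.powerset, F v
      = ∑ w : Finset {i // i ∈ u}, F (w.map (Function.Embedding.subtype _)) := by
  refine (Finset.sum_bij (fun w _ => w.map (Function.Embedding.subtype _)) ?_ ?_ ?_ ?_).symm
  · intro w _
    rw [Finset.mem_powerset]
    intro i hi
    obtain ⟨j, _, rfl⟩ := Finset.mem_map.1 hi
    exact j.2
  · intro w _ w' _ h
    exact Finset.map_injective _ h
  · intro v hv
    rw [Finset.mem_powerset] at hv
    refine ⟨v.subtype (· ∈ u), Finset.mem_univ _, ?_⟩
    rw [Finset.subtype_map, Finset.filter_true_of_mem hv]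
  · intros; rfl

/-- At a product of differences of levels in the coordinates `u`, the multilinear extension is an
integral over `y` of alternating sums of the marginal of `f`, taken over one box for each node. -/
lemma levelExtension_piecewise_sub (hf : Continuous f)
    (hx : ∀ n ∈ T, x n ∈ box (lo 2 p) (hi 2 p)) (u : Finset (Fin s)) (a b : Fin s → ℕ)
    (ha : ∀ i ∈ u, a i ≤ M + 1) (hb : ∀ i ∈ u, b i ≤ M + 1) :
    levelExtension M (levelSum p T x M f)
        (u.piecewise (fun i => Pi.single (a i) 1 - Pi.single (b i) 1) (fun _ => Pi.single 0 1))
      = ∫ y in box (fun i : {i // i ∈ u} => lo 2 p i) (fun i => hi 2 p i), ∑ n ∈ T,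
        altSum (marginal 2 p u f)
          (fun i => resolve M (lo 2 p i) (sideLen p i) (a i) (x n i) (y i))
          (fun i => resolve M (lo 2 p i) (sideLen p i) (b i) (x n i) (y i)) := by
  set lev : Finset (Fin s) → Fin s → ℕ := fun v => v.piecewise b (u.piecewise a 0) with hlev
  have hlev0 : ∀ v ∈ u.powerset, ∀ i ∉ u, lev v i = 0 := by
    intro v hv i hi
    have : i ∉ v := fun h => hi (Finset.mem_powerset.1 hv h)
    simp [hlev, this, hi]
  have hlevM : ∀ v ∈ u.powerset, ∀ i, lev v i ≤ M + 1 := by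
    intro v hv i
    by_cases hi : i ∈ u
    · by_cases hiv : i ∈ v
      · simp [hlev, hiv, hb i hi]
      · simp [hlev, hiv, hi, ha i hi]
    · rw [hlev0 v hv i hi]; omega
  have h1 : ∀ v ∈ u.powerset, levelExtension M (levelSum p T x M f)
      (v.piecewise (fun i => Pi.single (b i) 1)
        (u.piecewise (fun i => Pi.single (a i) 1) (fun _ => Pi.single 0 1)))
      = levelSum p T x M f (lev v) := by
    intro v hv
    rw [← levelExtension_single M (levelSum p T x M f) (lev v) (hlevM v hv)]
    congr 1
    ext i : 1
    by_cases hiv : i ∈ v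
    · simp [hlev, hiv]
    · by_cases hi : i ∈ u <;> simp [hlev, hiv, hi]
  rw [map_piecewise_sub, Finset.sum_congr rfl fun v hv => by rw [h1 v hv]]
  have h2 : ∀ v ∈ u.powerset, levelSum p T x M f (lev v)
      = ∑ n ∈ T, ∫ y in box (fun i : {i // i ∈ u} => lo 2 p i) (fun i => hi 2 p i),
        marginal 2 p u f fun i => resolve M (lo 2 p i) (sideLen p i) (lev v i) (x n i) (y i) := by
    intro v hv
    exact Finset.sum_congr rfl fun n hn =>
      (setIntegral_resolve_eq hf (hx n hn) u (lev v) (hlev0 v hv)).1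
  rw [Finset.sum_congr rfl fun v hv => by rw [h2 v hv]]
  have hint : ∀ v ∈ u.powerset, ∀ n ∈ T, IntegrableOn (fun y => marginal 2 p u f
      fun i : {i // i ∈ u} => resolve M (lo 2 p i) (sideLen p i) (lev v i) (x n i) (y i))
      (box (fun i : {i // i ∈ u} => lo 2 p i) (fun i => hi 2 p i)) := fun v hv n hn =>
    (setIntegral_resolve_eq hf (hx n hn) u (lev v) (hlev0 v hv)).2
  simp only [Finset.mul_sum]
  rw [Finset.sum_comm]
  simp only [← integral_const_mul]
  rw [Finset.sum_congr rfl fun n hn => (integral_finsetSum _ fun v hv =>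
    (hint v hv n hn).const_mul _).symm]
  rw [← integral_finsetSum _ fun n hn => integrable_finsetSum _ fun v hv =>
    (hint v hv n hn).const_mul _]
  congr 1
  ext y
  refine Finset.sum_congr rfl fun n _ => ?_
  rw [sum_powerset_eq_sum_subtype, altSum]
  refine Finset.sum_congr rfl fun w _ => ?_
  rw [Finset.card_map]
  congr 2
  ext i
  by_cases hi : i ∈ w
  · have : (i : Fin s) ∈ w.map (Function.Embedding.subtype _) := Finset.mem_map_of_mem _ hi
    simp only [hlev, hi, Finset.piecewise_eq_of_mem _ _ _ this, if_true]
  · have : (i : Fin s) ∉ w.map (Function.Embedding.subtype _) := by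
      intro h
      obtain ⟨j, hj, hji⟩ := Finset.mem_map.1 h
      exact hi (Subtype.ext hji ▸ hj)
    simp only [hlev, hi, Finset.piecewise_eq_of_notMem _ _ _ this, if_false,
      Finset.piecewise_eq_of_mem _ _ _ i.2]

/-- The hypothesis on products of differences in `abs_map_top_sub_le`: for each `y`, the boxes of
the nodes lie in their cells of levels `ρ`. -/
lemma abs_levelExtension_le {α : ℝ} (hα : 1 / 2 ≤ α) (hf : Continuous f)
    (hx : ∀ n ∈ T, x n ∈ box (lo 2 p) (hi 2 p)) (hT : EvenlyDistributed p T x M)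
    (u : Finset (Fin s)) {V : ℝ} (hV : 0 ≤ V)
    (hVu : vitaliVar α (fun i : {i // i ∈ u} => lo 2 p i) (fun i => hi 2 p i) (marginal 2 p u f)
      ≤ ENNReal.ofReal V)
    (ρ a b : Fin s → ℕ) (hρ : ∑ i ∈ u, ρ i ≤ M)
    (hab : ∀ i ∈ u, ρ i ≤ a i ∧ ρ i ≤ b i ∧ a i ≤ M + 1 ∧ b i ≤ M + 1) :
    |levelExtension M (levelSum p T x M f)
        (u.piecewise (fun i => Pi.single (a i) 1 - Pi.single (b i) 1) (fun _ => Pi.single 0 1))|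
      ≤ T.card * (∏ i ∈ u, sideLen p i) ^ (α + 1 / 2) * V * (2 ^ (-α)) ^ ∑ i ∈ u, ρ i := by
  have hxi : ∀ n ∈ T, ∀ i, x n i ∈ Ico (lo 2 p i) (lo 2 p i + sideLen p i) := by
    intro n hn i
    rw [← hi_eq]
    exact mem_box.1 (hx n hn) i
  rw [levelExtension_piecewise_sub hf hx u a b (fun i hi => (hab i hi).2.2.1)
    (fun i hi => (hab i hi).2.2.2)]
  set W := ∏ i ∈ u, sideLen p i with hW
  have hW0 : 0 < W := Finset.prod_pos fun i _ => sideLen_pos p i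
  have hWu : ∏ i : {i // i ∈ u}, sideLen p i = W := Finset.prod_coe_sort u (sideLen p)
  have hρu : ∑ i : {i // i ∈ u}, ρ i = ∑ i ∈ u, ρ i := Finset.sum_coe_sort u ρ
  set κ : ℕ → ∀ i : {i // i ∈ u}, Fin (2 ^ ρ i) := fun n i =>
    Fin.ofNat (2 ^ ρ i) (cellIdx (lo 2 p i) (sideLen p i) (ρ i) (x n i)) with hκ
  have hκv : ∀ n ∈ T, ∀ i : {i // i ∈ u},
      (κ n i : ℕ) = cellIdx (lo 2 p i) (sideLen p i) (ρ i) (x n i) := by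
    intro n hn i
    exact Nat.mod_eq_of_lt (cellIdx_lt (sideLen_pos p i) (hxi n hn i).1 (hxi n hn i).2 _)
  have hcount : ∀ k, (T.filter fun n => κ n = k).card * 2 ^ ∑ i : {i // i ∈ u}, ρ i = T.card := by
    intro k
    have hsum : ∑ i, (if i ∈ u then ρ i else 0) = ∑ i ∈ u, ρ i := by
      rw [Finset.sum_ite_mem, Finset.univ_inter]
    have h1 := hT (fun i => if i ∈ u then ρ i else 0) (by rw [hsum]; exact hρ)
      (fun i => if h : i ∈ u then k ⟨i, h⟩ else 0) (fun i => by
        by_cases h : i ∈ u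
        · simp [h]
        · simp [h])
    rw [hsum] at h1
    rw [hρu, ← h1]
    congr 2
    refine Finset.filter_congr fun n hn => ?_
    rw [funext_iff]
    constructor
    · intro h i
      by_cases hi : i ∈ u
      · simp only [hi, if_true, dif_pos]
        rw [← hκv n hn ⟨i, hi⟩, h]
      · simp only [hi, if_false, dif_neg, not_false_eq_true]
        exact cellIdx_zero (sideLen_pos p i) (hxi n hn i).1 (hxi n hn i).2
    · intro h i
      have := h i
      simp only [i.2, if_true, dif_pos] at this
      rw [Fin.ext_iff, hκv n hn, this]
  have hhi : (fun i : {i // i ∈ u} => hi 2 p i)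
      = fun i : {i // i ∈ u} => lo 2 p i + sideLen p i :=
    funext fun i => hi_eq p i
  have hbound : ∀ y ∈ box (fun i : {i // i ∈ u} => lo 2 p i) (fun i => hi 2 p i),
      ‖∑ n ∈ T, altSum (marginal 2 p u f)
          (fun i => resolve M (lo 2 p i) (sideLen p i) (a i) (x n i) (y i))
          (fun i => resolve M (lo 2 p i) (sideLen p i) (b i) (x n i) (y i))‖
        ≤ T.card * ((2 ^ (-α)) ^ (∑ i ∈ u, ρ i) * (W ^ (α - 1 / 2) * V)) := by
    intro y hy
    have hyi : ∀ i : {i // i ∈ u}, y i ∈ Ico (lo 2 p i) (lo 2 p i + sideLen p i) := by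
      intro i
      rw [← hi_eq]
      exact mem_box.1 hy i
    rw [hhi] at hVu
    rw [Real.norm_eq_abs]
    refine (Finset.abs_sum_le_sum_abs _ _).trans ?_
    have h2 := sum_abs_altSum_le hα hV (fun i : {i // i ∈ u} => sideLen_pos p i) hVu
      (fun i => ρ i) T κ hcount
      (fun n i => resolve M (lo 2 p i) (sideLen p i) (a i) (x n i) (y i))
      (fun n i => resolve M (lo 2 p i) (sideLen p i) (b i) (x n i) (y i))
      (fun n hn i => by
        rw [hκv n hn]
        exact Ico_subset_Icc_self
          (resolve_mem_cell (sideLen_pos p i) (hxi n hn i) (hyi i) (hab i i.2).1))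
      (fun n hn i => by
        rw [hκv n hn]
        exact Ico_subset_Icc_self
          (resolve_mem_cell (sideLen_pos p i) (hxi n hn i) (hyi i) (hab i i.2).2.1))
    rwa [hρu, hWu] at h2
  have h3 := norm_setIntegral_le_of_norm_le_const (volume_box_lt_top _ _) hbound
  rw [Real.norm_eq_abs] at h3
  refine h3.trans (le_of_eq ?_)
  have hvol : volume.real (box (fun i : {i // i ∈ u} => lo 2 p i) (fun i => hi 2 p i)) = W := by
    rw [volume_real_box fun i : {i // i ∈ u} => lo_le_hi p i, boxVol, ← hWu]
    exact Finset.prod_congr rfl fun i _ => by rw [hi_eq]; ring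
  rw [hvol, show α + 1 / 2 = α - 1 / 2 + 1 by ring, Real.rpow_add_one hW0.ne']
  ring

/-- The error in one elementary interval of the rule with equal weights at evenly distributed
nodes. -/
lemma abs_boxVol_mul_sum_sub_integral_le {α : ℝ} (hα : 1 / 2 ≤ α) (hf : Continuous f)
    (hTne : T.Nonempty) (hx : ∀ n ∈ T, x n ∈ box (lo 2 p) (hi 2 p))
    (hT : EvenlyDistributed p T x M) (V : Finset (Fin s) → ℝ) (hV : ∀ u, 0 ≤ V u)
    (hVu : ∀ u : Finset (Fin s), u.Nonempty →
      vitaliVar α (fun i : {i // i ∈ u} => lo 2 p i) (fun i => hi 2 p i) (marginal 2 p u f)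
        ≤ ENNReal.ofReal (V u)) :
    |boxVol (lo 2 p) (hi 2 p) / T.card * ∑ n ∈ T, f (x n) - ∫ y in box (lo 2 p) (hi 2 p), f y|
      ≤ ∑ u : Finset (Fin s), (∏ i ∈ u, sideLen p i) ^ (α + 1 / 2) * V u
          * ((2 ^ (-α)) ^ M * ((2 : ℝ) ^ (-α))⁻¹ ^ u.card) * (binomSum u.card M : ℝ) := by
  have hN : (0 : ℝ) < T.card := by exact_mod_cast hTne.card_pos
  have h := abs_map_top_sub_le (levelExtension M (levelSum p T x M f)) (fun r => Pi.single r 1) M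
    (T.card * ∫ y in box (lo 2 p) (hi 2 p), f y)
    (fun u => T.card * (∏ i ∈ u, sideLen p i) ^ (α + 1 / 2) * V u)
    (fun u => mul_nonneg (mul_nonneg hN.le (Real.rpow_nonneg
      (Finset.prod_nonneg fun i _ => (sideLen_pos p i).le) _)) (hV u))
    (2 ^ (-α)) (by positivity) (Real.rpow_le_one_of_one_le_of_nonpos (by norm_num) (by linarith))
    (fun r hr => by
      rw [levelExtension_single M _ r fun i => ?_, levelSum_eq hf hx hT r hr]
      have := Finset.single_le_sum (f := r) (fun _ _ => Nat.zero_le _) (Finset.mem_univ i)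
      omega)
    (fun u hu ρ a b hρ hab => abs_levelExtension_le hα hf hx hT u (hV u) (hVu u hu) ρ a b hρ hab)
  rw [levelExtension_single M _ _ fun i => le_rfl, levelSum_top] at h
  have h1 : boxVol (lo 2 p) (hi 2 p) / T.card * ∑ n ∈ T, f (x n)
        - ∫ y in box (lo 2 p) (hi 2 p), f y
      = (T.card : ℝ)⁻¹ * (boxVol (lo 2 p) (hi 2 p) * ∑ n ∈ T, f (x n)
        - T.card * ∫ y in box (lo 2 p) (hi 2 p), f y) := by
    field_simp
  rw [h1, abs_mul, abs_of_pos (inv_pos.2 hN)]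
  refine (mul_le_mul_of_nonneg_left h (inv_pos.2 hN).le).trans (le_of_eq ?_)
  rw [Finset.mul_sum]
  refine Finset.sum_congr rfl fun u _ => ?_
  field_simp

end Local

/-! ### The dyadic partition of the real line -/

/-- The distance from the origin of the `d`-th interval of the dyadic partition of the line (counted
from `d = 0`), in terms of `e = d / 2`. -/
def sideDist (e : ℕ) : ℝ := if e = 0 then 0 else 2 ^ (e - 1)

/-- The left end point of the `d`-th interval of the dyadic partition (counted from `d = 0`). -/
def sideLo (d : ℕ) : ℝ := (2 : ℝ) ^ (ratIdx (d + 1)).1 * (ratIdx (d + 1)).2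

/-- The right end point of the `d`-th interval of the dyadic partition (counted from `d = 0`). -/
def sideHi (d : ℕ) : ℝ := (2 : ℝ) ^ (ratIdx (d + 1)).1 * ((ratIdx (d + 1)).2 + 1)

lemma ratIdx_fst (d : ℕ) : (ratIdx (d + 1)).1 = ((d / 2 - 1 : ℕ) : ℤ) := by
  unfold ratIdx
  split_ifs with h1 h2 h3
  · simp [show d = 0 by omega]
  · simp [show d = 1 by omega]
  · obtain ⟨k, hk⟩ := h3; simp only; omega
  · obtain ⟨k, hk⟩ := Nat.not_odd_iff_even.1 h3; simp only; omega

lemma ratIdx_even (e : ℕ) : (ratIdx (2 * e + 1)).2 = if e = 0 then 0 else 1 := by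
  unfold ratIdx
  split_ifs with h1 h2 h3 h4 h5 h6 <;> first | rfl | omega | skip
  all_goals exact absurd ⟨e, by omega⟩ ‹¬ Odd (2 * e + 1)›

lemma ratIdx_odd (e : ℕ) : (ratIdx (2 * e + 1 + 1)).2 = if e = 0 then -1 else -2 := by
  have : ¬ Odd (2 * e + 1 + 1) := by rw [Nat.not_odd_iff_even]; exact ⟨e + 1, by ring⟩
  unfold ratIdx
  simp only [this, if_false]
  split_ifs with h1 h2 h3 h4 h5 <;> first | rfl | omega

lemma two_pow_eq {e : ℕ} (he : e ≠ 0) : (2 : ℝ) ^ e = 2 ^ (e - 1) * 2 := by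
  rw [← pow_succ]; congr 1; omega

lemma sideLo_even (e : ℕ) : sideLo (2 * e) = sideDist e := by
  rw [sideLo, ratIdx_fst, ratIdx_even, sideDist, show 2 * e / 2 - 1 = e - 1 by omega]
  split_ifs <;> simp

lemma sideHi_even (e : ℕ) : sideHi (2 * e) = 2 ^ e := by
  rw [sideHi, ratIdx_fst, ratIdx_even, show 2 * e / 2 - 1 = e - 1 by omega, zpow_natCast]
  split_ifs with h
  · simp [h]
  · rw [two_pow_eq h]; norm_num

lemma sideLo_odd (e : ℕ) : sideLo (2 * e + 1) = -2 ^ e := by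
  rw [sideLo, ratIdx_fst, ratIdx_odd, show (2 * e + 1) / 2 - 1 = e - 1 by omega, zpow_natCast]
  split_ifs with h
  · simp [h]
  · rw [two_pow_eq h]; norm_num

lemma sideHi_odd (e : ℕ) : sideHi (2 * e + 1) = -sideDist e := by
  rw [sideHi, ratIdx_fst, ratIdx_odd, sideDist, show (2 * e + 1) / 2 - 1 = e - 1 by omega,
    zpow_natCast]
  split_ifs with h
  · simp
  · push_cast; ring

lemma sideDist_nonneg (e : ℕ) : 0 ≤ sideDist e := by
  unfold sideDist; split_ifs <;> positivity

lemma two_pow_le_sideDist {e e' : ℕ} (h : e < e') : (2 : ℝ) ^ e ≤ sideDist e' := by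
  rw [sideDist, if_neg (by omega)]
  exact pow_le_pow_right₀ (by norm_num) (by omega)

lemma sideDist_le_two_pow (e : ℕ) : sideDist e ≤ 2 ^ e := by
  unfold sideDist
  split_ifs
  · positivity
  · exact pow_le_pow_right₀ (by norm_num) (by omega)

lemma min_abs_side (d : ℕ) : min |sideLo d| |sideHi d| = sideDist (d / 2) := by
  have h1 := sideDist_nonneg (d / 2)
  have h2 := sideDist_le_two_pow (d / 2)
  have h3 : |(2 : ℝ) ^ (d / 2)| = 2 ^ (d / 2) := abs_of_pos (by positivity)
  rcases Nat.even_or_odd' d with ⟨e, rfl | rfl⟩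
  · rw [show 2 * e / 2 = e by omega] at *
    rw [sideLo_even, sideHi_even, abs_of_nonneg h1, h3, min_eq_left h2]
  · rw [show (2 * e + 1) / 2 = e by omega] at *
    rw [sideLo_odd, sideHi_odd, abs_neg, abs_neg, abs_of_nonneg h1, h3, min_eq_right h2]

lemma side_unique {x : ℝ} {d d' : ℕ} (h : x ∈ Ico (sideLo d) (sideHi d))
    (h' : x ∈ Ico (sideLo d') (sideHi d')) : d = d' := by
  have key : ∀ e e', x ∈ Ico (sideLo (2 * e)) (sideHi (2 * e)) →
      x ∈ Ico (sideLo (2 * e')) (sideHi (2 * e')) → ¬ e < e' := by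
    intro e e' h1 h2 hlt
    rw [sideLo_even, sideHi_even] at h1 h2
    linarith [two_pow_le_sideDist hlt, h1.2, h2.1]
  have key' : ∀ e e', x ∈ Ico (sideLo (2 * e + 1)) (sideHi (2 * e + 1)) →
      x ∈ Ico (sideLo (2 * e' + 1)) (sideHi (2 * e' + 1)) → ¬ e < e' := by
    intro e e' h1 h2 hlt
    rw [sideLo_odd, sideHi_odd] at h1 h2
    linarith [two_pow_le_sideDist hlt, h1.1, h2.2]
  have key2 : ∀ e e', x ∈ Ico (sideLo (2 * e)) (sideHi (2 * e)) →
      x ∈ Ico (sideLo (2 * e' + 1)) (sideHi (2 * e' + 1)) → False := by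
    intro e e' h1 h2
    rw [sideLo_even] at h1
    rw [sideHi_odd] at h2
    linarith [sideDist_nonneg e, sideDist_nonneg e', h1.1, h2.2]
  rcases Nat.even_or_odd' d with ⟨e, rfl | rfl⟩ <;>
    rcases Nat.even_or_odd' d' with ⟨e', rfl | rfl⟩
  · have := key e e' h h'
    have := key e' e h' h
    omega
  · exact (key2 _ _ h h').elim
  · exact (key2 _ _ h' h).elim
  · have := key' e e' h h'
    have := key' e' e h' h
    omega

lemma side_exists (x : ℝ) : ∃ d, x ∈ Ico (sideLo d) (sideHi d) := by
  rcases le_or_gt 0 x with h0 | h0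
  · rcases lt_or_ge x 1 with h1 | h1
    · refine ⟨2 * 0, ?_⟩
      rw [sideLo_even, sideHi_even]
      simpa [sideDist] using ⟨h0, h1⟩
    · obtain ⟨k, hk, hk'⟩ := exists_nat_pow_near h1 (by norm_num : (1 : ℝ) < 2)
      refine ⟨2 * (k + 1), ?_⟩
      rw [sideLo_even, sideHi_even]
      simpa [sideDist] using ⟨hk, hk'⟩
  · rcases le_or_gt (-1) x with h1 | h1
    · refine ⟨2 * 0 + 1, ?_⟩
      rw [sideLo_odd, sideHi_odd]
      simpa [sideDist] using ⟨h1, h0⟩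
    · obtain ⟨n, hn, hn'⟩ := exists_mem_Ioc_zpow (by linarith : 0 < -x) (by norm_num : (1 : ℝ) < 2)
      have hn0 : 0 ≤ n := by
        by_contra! h
        have : (2 : ℝ) ^ (n + 1) ≤ 1 := zpow_le_one_of_nonpos₀ (by norm_num) (by omega)
        linarith
      lift n to ℕ using hn0
      have e1 : (2 : ℝ) ^ ((n : ℤ) + 1) = 2 ^ (n + 1) := by exact_mod_cast zpow_natCast (2 : ℝ) _
      rw [zpow_natCast] at hn
      rw [e1] at hn'
      refine ⟨2 * (n + 1) + 1, ?_⟩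
      rw [sideLo_odd, sideHi_odd, sideDist, if_neg (by omega), Nat.add_sub_cancel]
      constructor <;> linarith

/-! ### The product partition -/

/-- The box of the product partition with sides numbered by `d` (counted from `0`). -/
def ratBox {s : ℕ} (d : Fin s → ℕ) : BoxIdx s :=
  (fun i => (ratIdx (d i + 1)).1, fun i => (ratIdx (d i + 1)).2)

lemma lo_ratBox {s : ℕ} (d : Fin s → ℕ) (i : Fin s) : lo 2 (ratBox d) i = sideLo (d i) := by
  simp [lo, ratBox, sideLo]

lemma hi_ratBox {s : ℕ} (d : Fin s → ℕ) (i : Fin s) : hi 2 (ratBox d) i = sideHi (d i) := by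
  simp [hi, ratBox, sideHi]

lemma sideLen_ratBox {s : ℕ} (d : Fin s → ℕ) (i : Fin s) :
    sideLen (ratBox d) i = 2 ^ (d i / 2 - 1) := by
  simp only [sideLen, ratBox]
  rw [ratIdx_fst, zpow_natCast]

lemma mem_elemInterval_ratBox {s : ℕ} {d : Fin s → ℕ} {x : Fin s → ℝ} :
    x ∈ elemInterval 2 (ratBox d) ↔ ∀ i, x i ∈ Ico (sideLo (d i)) (sideHi (d i)) := by
  rw [elemInterval, mem_box]
  simp only [lo_ratBox, hi_ratBox]

lemma ratBox_unique {s : ℕ} {d d' : Fin s → ℕ} {x : Fin s → ℝ}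
    (h : x ∈ elemInterval 2 (ratBox d)) (h' : x ∈ elemInterval 2 (ratBox d')) : d = d' :=
  funext fun i => side_unique (mem_elemInterval_ratBox.1 h i) (mem_elemInterval_ratBox.1 h' i)

lemma ratBox_exists {s : ℕ} (x : Fin s → ℝ) : ∃ d : Fin s → ℕ, x ∈ elemInterval 2 (ratBox d) := by
  choose d hd using fun i => side_exists (x i)
  exact ⟨d, mem_elemInterval_ratBox.2 hd⟩

lemma lo_mem_elemInterval {s : ℕ} (p : BoxIdx s) : lo 2 p ∈ elemInterval 2 p :=
  mem_box.2 fun i => ⟨le_rfl, by rw [hi_eq]; linarith [sideLen_pos p i]⟩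

lemma ratBox_injective (s : ℕ) : Function.Injective (ratBox : (Fin s → ℕ) → BoxIdx s) := by
  intro d d' h
  have h1 := lo_mem_elemInterval (ratBox d)
  exact ratBox_unique h1 (h ▸ h1)

lemma range_ratBox (s : ℕ) : Set.range (ratBox : (Fin s → ℕ) → BoxIdx s) = ratPartition s := by
  ext p
  simp only [Set.mem_range, ratPartition, Set.mem_ofPred_eq]
  constructor
  · rintro ⟨d, rfl⟩ i
    exact ⟨d i + 1, by omega, rfl⟩
  · intro h
    choose d hd hd' using h
    refine ⟨fun i => d i - 1, ?_⟩
    have h1 : ∀ i, d i - 1 + 1 = d i := fun i => Nat.sub_add_cancel (hd i)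
    simp only [ratBox, h1, ← hd']

/-- The boxes of the product partition, numbered by `Fin s → ℕ`. -/
def ratEquiv (s : ℕ) : (Fin s → ℕ) ≃ ratPartition s :=
  (Equiv.ofInjective _ (ratBox_injective s)).trans (Equiv.setCongr (range_ratBox s))

lemma iUnion_elemInterval_ratBox (s : ℕ) :
    ⋃ d : Fin s → ℕ, elemInterval 2 (ratBox d) = Set.univ :=
  Set.eq_univ_of_forall fun x => Set.mem_iUnion.2 (ratBox_exists x)

lemma pairwise_disjoint_elemInterval_ratBox (s : ℕ) :
    Pairwise (Function.onFun Disjoint fun d : Fin s → ℕ => elemInterval 2 (ratBox d)) := by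
  intro d d' h
  rw [Function.onFun, Set.disjoint_left]
  exact fun x hx hx' => h (ratBox_unique hx hx')

/-! ### The one-dimensional nodes -/

/-- The first label that belongs to the `d`-th interval (counted from `0`). -/
def labelStart (c : ℕ → ℕ) (d : ℕ) : ℕ := ∑ e ∈ Finset.Ico 1 (d + 1), 2 ^ c e

lemma labelStart_succ (c : ℕ → ℕ) (d : ℕ) :
    labelStart c (d + 1) = labelStart c d + 2 ^ c (d + 1) := by
  rw [labelStart, Finset.sum_Ico_succ_top (by omega), labelStart]

lemma labelStart_mono (c : ℕ → ℕ) : Monotone (labelStart c) :=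
  monotone_nat_of_le_succ fun d => by rw [labelStart_succ]; exact Nat.le_add_right _ _

lemma exists_label (c : ℕ → ℕ) (n : ℕ) :
    ∃ d, labelStart c d ≤ n ∧ n < labelStart c (d + 1) := by
  have hle : ∀ d, d ≤ labelStart c d := by
    intro d
    induction d with
    | zero => omega
    | succ d ih => rw [labelStart_succ]; have := Nat.one_le_two_pow (n := c (d + 1)); omega
  have hex : ∃ d, n < labelStart c (d + 1) := ⟨n, by have := hle (n + 1); omega⟩
  refine ⟨Nat.find hex, ?_, Nat.find_spec hex⟩
  rcases h : Nat.find hex with _ | d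
  · simp [labelStart]
  · exact not_lt.1 (Nat.find_min hex (m := d) (by omega))

lemma zPoint_eq (c : ℕ → ℕ) {n d : ℕ} (h1 : labelStart c d ≤ n) (h2 : n < labelStart c (d + 1)) :
    zPoint 2 ratIdx c n
      = sideLo d + (sideHi d - sideLo d) * (((n - labelStart c d : ℕ) : ℝ) / 2 ^ c (d + 1)) := by
  have hS : ∀ d, ∑ e ∈ Finset.Icc 1 d, 2 ^ c e = labelStart c d := fun d => rfl
  have hd : sInf {d | n < ∑ e ∈ Finset.Icc 1 d, 2 ^ c e} = d + 1 := by
    refine le_antisymm (Nat.sInf_le (by simpa [hS] using h2)) ?_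
    have hne : {d | n < ∑ e ∈ Finset.Icc 1 d, 2 ^ c e}.Nonempty := ⟨d + 1, by simpa [hS] using h2⟩
    have h3 := Nat.sInf_mem hne
    set D := sInf {d | n < ∑ e ∈ Finset.Icc 1 d, 2 ^ c e}
    by_contra! h4
    have h5 : n < labelStart c D := h3
    have h6 := labelStart_mono c (show D ≤ d by omega)
    omega
  simp only [zPoint, hd]
  rw [zpow_sub₀ (by norm_num), zpow_natCast]
  simp only [sideLo, sideHi, labelStart]
  push_cast
  ring

lemma sideHi_sub_sideLo (d : ℕ) : sideHi d - sideLo d = 2 ^ (d / 2 - 1) := by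
  rw [sideHi, sideLo, ratIdx_fst, zpow_natCast]; ring

lemma zPoint_mem (c : ℕ → ℕ) {n d : ℕ} (h1 : labelStart c d ≤ n)
    (h2 : n < labelStart c (d + 1)) : zPoint 2 ratIdx c n ∈ Ico (sideLo d) (sideHi d) := by
  rw [zPoint_eq c h1 h2]
  have hlen : 0 < sideHi d - sideLo d := by rw [sideHi_sub_sideLo]; positivity
  have h3 : (((n - labelStart c d : ℕ) : ℝ) / 2 ^ c (d + 1)) < 1 := by
    rw [div_lt_one (by positivity)]
    rw [labelStart_succ] at h2
    exact_mod_cast (by omega : n - labelStart c d < 2 ^ c (d + 1))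
  constructor
  · have : 0 ≤ (sideHi d - sideLo d) * (((n - labelStart c d : ℕ) : ℝ) / 2 ^ c (d + 1)) := by
      positivity
    linarith
  · nlinarith

/-- The nodes in a dyadic cell of the `d`-th interval are those with labels in a block. -/
lemma zPoint_mem_cell_iff (c : ℕ → ℕ) {n d r k : ℕ} (hr : r ≤ c (d + 1)) (hk : k < 2 ^ r) :
    (zPoint 2 ratIdx c n ∈ Ico (sideLo d) (sideHi d) ∧
      cellIdx (sideLo d) (2 ^ (d / 2 - 1)) r (zPoint 2 ratIdx c n) = k) ↔
    labelStart c d + k * 2 ^ (c (d + 1) - r) ≤ n ∧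
      n < labelStart c d + (k + 1) * 2 ^ (c (d + 1) - r) := by
  set q := 2 ^ (c (d + 1) - r) with hq
  have hq0 : 0 < q := by positivity
  have hqr : 2 ^ c (d + 1) = 2 ^ r * q := by rw [hq, ← pow_add]; congr 1; omega
  have hidx : labelStart c d ≤ n → n < labelStart c (d + 1) →
      cellIdx (sideLo d) (2 ^ (d / 2 - 1)) r (zPoint 2 ratIdx c n) = (n - labelStart c d) / q := by
    intro h1 h2
    have e1 : ((2 : ℝ) ^ c (d + 1)) = 2 ^ r * (q : ℝ) := by exact_mod_cast hqr
    have e2 : (q : ℝ) ≠ 0 := by positivity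
    rw [zPoint_eq c h1 h2, cellIdx, sideHi_sub_sideLo, add_sub_cancel_left, e1]
    rw [show (2 : ℝ) ^ (d / 2 - 1) * (((n - labelStart c d : ℕ) : ℝ) / (2 ^ r * q))
        / 2 ^ (d / 2 - 1) * 2 ^ r = ((n - labelStart c d : ℕ) : ℝ) / q by field_simp]
    exact Nat.floor_div_eq_div _ _
  have hdiv : labelStart c d ≤ n → ((n - labelStart c d) / q = k ↔
      labelStart c d + k * q ≤ n ∧ n < labelStart c d + (k + 1) * q) := by
    intro h1
    rw [Nat.div_eq_iff hq0]
    have : (k + 1) * q = k * q + q := by ring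
    omega
  constructor
  · rintro ⟨h1, h2⟩
    obtain ⟨d', hd1, hd2⟩ := exists_label c n
    obtain rfl := side_unique h1 (zPoint_mem c hd1 hd2)
    rw [hidx hd1 hd2] at h2
    exact (hdiv hd1).1 h2
  · rintro ⟨h1, h2⟩
    have h3 : labelStart c d ≤ n := by omega
    have h4 : n < labelStart c (d + 1) := by
      rw [labelStart_succ, hqr]
      have : (k + 1) * q ≤ 2 ^ r * q := Nat.mul_le_mul_right _ hk
      omega
    refine ⟨zPoint_mem c h3 h4, ?_⟩
    rw [hidx h3 h4]
    exact (hdiv h3).2 ⟨h1, h2⟩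

/-! ### Counting nodes of a net -/

/-- In a `(t, m, s)`-net also the larger elementary intervals contain their share of the points. -/
lemma IsNet.ncard_mul {t m s : ℕ} {x : ℕ → Fin s → ℝ} (h : IsNet 2 t m s x) (hs : 0 < s) :
    ∀ k : ℕ, ∀ d A : Fin s → ℕ, ∑ i, d i + k = m - t → (∀ i, A i < 2 ^ d i) →
      {n | n < 2 ^ m ∧ x n ∈ box (fun i => (A i : ℝ) / 2 ^ d i)
        (fun i => ((A i : ℝ) + 1) / 2 ^ d i)}.ncard * 2 ^ ∑ i, d i = 2 ^ m := by
  intro k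
  induction k with
  | zero =>
    intro d A hd hA
    have h1 := h.2.2 d A (by omega) hA
    push_cast at h1
    rw [h1, ← pow_add]
    congr 1
    have := h.1
    omega
  | succ k ih =>
    intro d A hd hA
    set i₀ : Fin s := ⟨0, hs⟩
    set d' := Function.update d i₀ (d i₀ + 1) with hd'
    have hsum : ∑ i, d' i = ∑ i, d i + 1 := by
      rw [hd', Finset.sum_update_of_mem (Finset.mem_univ _), Finset.sdiff_singleton_eq_erase]
      have := Finset.add_sum_erase Finset.univ d (Finset.mem_univ i₀)
      omega
    -- the two halves of the interval in direction `i₀`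
    set A₀ : ℕ → Fin s → ℕ := fun b => Function.update A i₀ (2 * A i₀ + b) with hA₀
    have hA₀lt : ∀ b < 2, ∀ i, A₀ b i < 2 ^ d' i := by
      intro b hb i
      have := hA i
      rcases eq_or_ne i i₀ with rfl | hi
      · simp only [hA₀, hd', Function.update_self, pow_succ]; omega
      · simpa [hA₀, hd', hi] using this
    set X : ℕ → Set ℕ := fun b => {n | n < 2 ^ m ∧ x n ∈ box (fun i => (A₀ b i : ℝ) / 2 ^ d' i)
        (fun i => ((A₀ b i : ℝ) + 1) / 2 ^ d' i)} with hX
    have hX0 := ih d' (A₀ 0) (by omega) (hA₀lt 0 (by omega))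
    have hX1 := ih d' (A₀ 1) (by omega) (hA₀lt 1 (by omega))
    have hfin : ∀ b, (X b).Finite := fun b => (Set.finite_lt_nat (2 ^ m)).subset fun n hn => hn.1
    have hmem : ∀ b n, x n ∈ box (fun i => (A₀ b i : ℝ) / 2 ^ d' i)
        (fun i => ((A₀ b i : ℝ) + 1) / 2 ^ d' i) ↔
        (∀ i ≠ i₀, x n i ∈ Ico ((A i : ℝ) / 2 ^ d i) (((A i : ℝ) + 1) / 2 ^ d i)) ∧
        2 * (A i₀ : ℝ) + b ≤ x n i₀ * 2 ^ (d i₀ + 1) ∧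
          x n i₀ * 2 ^ (d i₀ + 1) < 2 * (A i₀ : ℝ) + b + 1 := by
      intro b n
      rw [mem_box]
      constructor
      · intro hx
        refine ⟨fun i hi => by simpa [hA₀, hd', hi] using hx i, ?_⟩
        have := hx i₀
        simp only [hA₀, hd', Function.update_self, mem_Ico] at this
        rw [div_le_iff₀ (by positivity), lt_div_iff₀ (by positivity)] at this
        push_cast at this
        exact this
      · rintro ⟨h1, h2⟩ i
        rcases eq_or_ne i i₀ with rfl | hi
        · simp only [hA₀, hd', Function.update_self, mem_Ico]
          rw [div_le_iff₀ (by positivity), lt_div_iff₀ (by positivity)]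
          push_cast
          exact h2
        · simpa [hA₀, hd', hi] using h1 i hi
    have hunion : {n | n < 2 ^ m ∧ x n ∈ box (fun i => (A i : ℝ) / 2 ^ d i)
        (fun i => ((A i : ℝ) + 1) / 2 ^ d i)} = X 0 ∪ X 1 := by
      ext n
      simp only [hX, Set.mem_ofPred_eq, Set.mem_union, hmem]
      rw [← and_or_left, ← and_or_left, mem_box]
      refine and_congr_right fun _ => ?_
      have h3 : x n i₀ ∈ Ico ((A i₀ : ℝ) / 2 ^ d i₀) (((A i₀ : ℝ) + 1) / 2 ^ d i₀) ↔
          2 * (A i₀ : ℝ) ≤ x n i₀ * 2 ^ (d i₀ + 1) ∧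
            x n i₀ * 2 ^ (d i₀ + 1) < 2 * (A i₀ : ℝ) + 2 := by
        rw [mem_Ico, div_le_iff₀ (by positivity), lt_div_iff₀ (by positivity), pow_succ]
        constructor <;> rintro ⟨h4, h5⟩ <;> constructor <;> linarith
      constructor
      · intro hx
        refine ⟨fun i _ => hx i, ?_⟩
        obtain ⟨h4, h5⟩ := h3.1 (hx i₀)
        rcases lt_or_ge (x n i₀ * 2 ^ (d i₀ + 1)) (2 * (A i₀ : ℝ) + 1) with h6 | h6
        · left; push_cast; constructor <;> linarith
        · right; push_cast; constructor <;> linarith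
      · rintro ⟨h1, h2⟩ i
        rcases eq_or_ne i i₀ with rfl | hi
        · refine h3.2 ?_
          push_cast at h2
          rcases h2 with h2 | h2 <;> constructor <;> linarith [h2.1, h2.2]
        · exact h1 i hi
    have hdisj : Disjoint (X 0) (X 1) := by
      rw [Set.disjoint_left]
      intro n h0 h1
      have h2 := ((hmem 0 n).1 h0.2).2.2
      have h3 := ((hmem 1 n).1 h1.2).2.1
      push_cast at h2 h3
      linarith
    rw [hunion, Set.ncard_union_eq hdisj (hfin 0) (hfin 1)]
    rw [hsum, pow_succ] at hX0 hX1
    change (X 0).ncard * _ = _ at hX0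
    change (X 1).ncard * _ = _ at hX1
    have : 2 * (((X 0).ncard + (X 1).ncard) * 2 ^ ∑ i, d i) = 2 * 2 ^ m := by
      calc _ = (X 0).ncard * (2 ^ (∑ i, d i) * 2) + (X 1).ncard * (2 ^ (∑ i, d i) * 2) := by ring
        _ = _ := by rw [hX0, hX1]; ring
    omega

lemma labelStart_ratCount {m : ℕ} : ∀ k ≤ m - 2, 2 ≤ m →
    labelStart (ratCount m) (2 * k) + 2 ^ (m - k) = 2 ^ m := by
  intro k
  induction k with
  | zero => intro _ _; simp [labelStart]
  | succ k ih =>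
    intro hk hm
    have h1 := ih (by omega) hm
    rw [show 2 * (k + 1) = 2 * k + 1 + 1 by ring, labelStart_succ, labelStart_succ]
    have h2 : ratCount m (2 * k + 1) = m - 2 - k := by
      rw [ratCount, if_pos (by omega)]; omega
    have h3 : ratCount m (2 * k + 1 + 1) = m - 2 - k := by
      rw [ratCount, if_pos (by omega)]; omega
    rw [h2, h3, ← h1, show m - k = m - 2 - k + 1 + 1 by omega,
      show m - (k + 1) = m - 2 - k + 1 by omega]
    ring

lemma labelStart_ratCount_le {m d : ℕ} (hm : 2 ≤ m) (hd : d ≤ 2 * (m - 2)) :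
    labelStart (ratCount m) d ≤ 2 ^ m := by
  have h1 := labelStart_ratCount (m := m) (m - 2) le_rfl hm
  exact (labelStart_mono (ratCount m) hd).trans (h1 ▸ Nat.le_add_right _ _)

lemma ratCount_eq {m d : ℕ} (hd : d + 1 ≤ 2 * (m - 2)) : ratCount m (d + 1) = m - 2 - d / 2 := by
  rw [ratCount, if_pos hd]; omega

lemma two_pow_dvd_labelStart {m d : ℕ} (hd : d + 1 ≤ 2 * (m - 2)) :
    2 ^ ratCount m (d + 1) ∣ labelStart (ratCount m) d := by
  refine Finset.dvd_sum fun e he => pow_dvd_pow _ ?_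
  rw [Finset.mem_Ico] at he
  rw [ratCount, if_pos hd, ratCount, if_pos (by omega)]
  omega

/-- A dyadic cell of level `r` of the `d`-th interval corresponds to an elementary interval of
length `2 ^ (-(2 + d / 2 + r))` for the net. -/
lemma exists_netCell {m d r k : ℕ} (hm : 2 ≤ m) (hd : d + 1 ≤ 2 * (m - 2))
    (hr : 2 + d / 2 + r ≤ m) (hk : k < 2 ^ r) :
    ∃ A : ℕ, A < 2 ^ (2 + d / 2 + r) ∧ ∀ n : ℕ,
      (zPoint 2 ratIdx (ratCount m) n ∈ Ico (sideLo d) (sideHi d) ∧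
        cellIdx (sideLo d) (2 ^ (d / 2 - 1)) r (zPoint 2 ratIdx (ratCount m) n) = k) ↔
      (n : ℝ) / 2 ^ m ∈
        Ico ((A : ℝ) / 2 ^ (2 + d / 2 + r)) (((A : ℝ) + 1) / 2 ^ (2 + d / 2 + r)) := by
  have hc := ratCount_eq hd
  set c := ratCount m (d + 1) with hcdef
  set D := 2 + d / 2 + r with hD
  have hrc : r ≤ c := by omega
  have hq : c - r = m - D := by omega
  obtain ⟨B, hB⟩ : 2 ^ (c - r) ∣ labelStart (ratCount m) d :=
    (pow_dvd_pow 2 (Nat.sub_le c r)).trans (two_pow_dvd_labelStart hd)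
  have hmD : 2 ^ m = 2 ^ D * 2 ^ (m - D) := by rw [← pow_add]; congr 1; omega
  refine ⟨B + k, ?_, fun n => ?_⟩
  · have h1 := labelStart_ratCount_le hm hd
    rw [labelStart_succ, ← hcdef, hB] at h1
    have h2 : 2 ^ c = 2 ^ r * 2 ^ (c - r) := by rw [← pow_add]; congr 1; omega
    rw [h2, hmD, hq] at h1
    have h3 : 0 < 2 ^ (m - D) := by positivity
    have h4 : (B + 2 ^ r) * 2 ^ (m - D) ≤ 2 ^ D * 2 ^ (m - D) := by
      calc _ = 2 ^ (m - D) * B + 2 ^ r * 2 ^ (m - D) := by ring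
        _ ≤ _ := h1
    exact (Nat.add_lt_add_left hk B).trans_le (Nat.le_of_mul_le_mul_right h4 h3)
  · rw [zPoint_mem_cell_iff (ratCount m) hrc hk, ← hcdef, hB, hq, mem_Ico,
      div_le_div_iff₀ (by positivity) (by positivity), div_lt_div_iff₀ (by positivity)
      (by positivity)]
    have e1 : ((2 : ℝ) ^ m) = 2 ^ D * 2 ^ (m - D) := by exact_mod_cast hmD
    have hpos : (0 : ℝ) < 2 ^ D := by positivity
    rw [e1, show ((B + k : ℕ) : ℝ) * (2 ^ D * 2 ^ (m - D))
        = (2 ^ (m - D) * B + k * 2 ^ (m - D)) * 2 ^ D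
      by push_cast; ring, show (((B + k : ℕ) : ℝ) + 1) * (2 ^ D * 2 ^ (m - D))
        = (2 ^ (m - D) * B + (k + 1) * 2 ^ (m - D)) * 2 ^ D by push_cast; ring,
      mul_le_mul_iff_left₀ hpos, mul_lt_mul_iff_left₀ hpos]
    refine and_congr ?_ ?_
    · exact_mod_cast Iff.rfl
    · exact_mod_cast Iff.rfl

/-- The indices of the nodes in the box `d`. -/
def nodesIn (m s : ℕ) (C : Fin s → Matrix (Fin m) (Fin m) (ZMod 2)) (d : Fin s → ℕ) :
    Finset ℕ :=
  open Classical in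
  (Finset.range (2 ^ m)).filter fun n => ratNode m s C n ∈ elemInterval 2 (ratBox d)

lemma mem_nodesIn {m s : ℕ} {C : Fin s → Matrix (Fin m) (Fin m) (ZMod 2)} {d : Fin s → ℕ} {n : ℕ} :
    n ∈ nodesIn m s C d ↔ n < 2 ^ m ∧ ratNode m s C n ∈ elemInterval 2 (ratBox d) := by
  classical
  simp [nodesIn]

lemma card_cell_mul {t m s : ℕ} (hs : 2 ≤ s) (hm : t + 3 * s < m)
    {C : Fin s → Matrix (Fin m) (Fin m) (ZMod 2)} (hC : IsDigitalNet 2 t m s C) (d : Fin s → ℕ)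
    (r k : Fin s → ℕ) (hr : ∑ i, d i / 2 + ∑ i, r i ≤ m - t - 2 * s) (hk : ∀ i, k i < 2 ^ r i) :
    ((nodesIn m s C d).filter fun n => ∀ i, cellIdx (lo 2 (ratBox d) i) (sideLen (ratBox d) i) (r i)
      (ratNode m s C n i) = k i).card * 2 ^ (∑ i, (2 + d i / 2 + r i)) = 2 ^ m := by
  have hi : ∀ i, d i / 2 + r i ≤ m - t - 2 * s := by
    intro i
    have h1 := Finset.single_le_sum (f := fun i => d i / 2 + r i) (fun _ _ => Nat.zero_le _)
      (Finset.mem_univ i)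
    simp only [Finset.sum_add_distrib] at h1
    omega
  have hex := fun i => exists_netCell (m := m) (d := d i) (r := r i) (k := k i) (by omega)
    (by have := hi i; omega) (by have := hi i; omega) (hk i)
  choose A hA hAiff using hex
  have hsum : ∑ i, (2 + d i / 2 + r i) = 2 * s + (∑ i, d i / 2 + ∑ i, r i) := by
    simp only [Finset.sum_add_distrib, Finset.sum_const, Finset.card_univ, Fintype.card_fin,
      smul_eq_mul]
    ring
  have h := IsNet.ncard_mul hC (by omega) (m - t - ∑ i, (2 + d i / 2 + r i))
    (fun i => 2 + d i / 2 + r i) A (by omega) hA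
  rw [← h]
  congr 1
  rw [← Set.ncard_coe_finset]
  congr 1
  ext n
  simp only [Finset.coe_filter, mem_nodesIn, Set.mem_ofPred_eq, mem_elemInterval_ratBox, mem_box,
    and_assoc, ← forall_and, lo_ratBox, sideLen_ratBox]
  refine and_congr_right fun _ => forall_congr' fun i => ?_
  exact hAiff i _

/-- The boxes near the origin contain nodes, which are evenly distributed. -/
lemma nodesIn_evenlyDistributed {t m s : ℕ} (hs : 2 ≤ s) (hm : t + 3 * s < m)
    {C : Fin s → Matrix (Fin m) (Fin m) (ZMod 2)} (hC : IsDigitalNet 2 t m s C) (d : Fin s → ℕ)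
    (hd : ∑ i, d i / 2 ≤ m - t - 2 * s) :
    (nodesIn m s C d).Nonempty ∧ EvenlyDistributed (ratBox d) (nodesIn m s C d) (ratNode m s C)
      (m - t - 2 * s - ∑ i, d i / 2) := by
  -- the case of level zero gives the number of nodes in the box
  have hzero : (nodesIn m s C d).filter (fun n => ∀ i, cellIdx (lo 2 (ratBox d) i)
      (sideLen (ratBox d) i) ((0 : Fin s → ℕ) i) (ratNode m s C n i) = (0 : Fin s → ℕ) i)
      = nodesIn m s C d := by
    refine Finset.filter_true_of_mem fun n hn i => ?_
    have h1 := mem_box.1 (mem_nodesIn.1 hn).2 i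
    rw [hi_eq] at h1
    exact cellIdx_zero (sideLen_pos _ i) h1.1 h1.2
  have h0 := card_cell_mul hs hm hC d 0 0 (by simpa using hd) (by simp)
  rw [hzero] at h0
  refine ⟨?_, ?_⟩
  · rw [← Finset.card_pos]
    by_contra h
    rw [Nat.eq_zero_of_not_pos h, zero_mul] at h0
    exact absurd h0.symm (by positivity)
  · intro r hr k hk
    have h1 := card_cell_mul hs hm hC d r k (by omega) hk
    have hpos : 0 < 2 ^ ∑ i, (2 + d i / 2 + (0 : Fin s → ℕ) i) := by positivity
    refine Nat.eq_of_mul_eq_mul_right hpos ?_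
    rw [h0, ← h1, mul_assoc, ← pow_add]
    congr 2
    simp only [Finset.sum_add_distrib, Pi.zero_apply, Finset.sum_const_zero]
    ring

/-- Without any assumption, all nodes of a box lie in its only cell of level zero. -/
lemma evenlyDistributed_zero {s : ℕ} {p : BoxIdx s} {T : Finset ℕ} {x : ℕ → Fin s → ℝ}
    (hx : ∀ n ∈ T, x n ∈ elemInterval 2 p) : EvenlyDistributed p T x 0 := by
  intro ρ hρ k hk
  have hρ0 : ∀ i, ρ i = 0 := by simpa using hρ
  have hk0 : ∀ i, k i = 0 := fun i => by have := hk i; rw [hρ0] at this; simpa using this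
  rw [Finset.filter_true_of_mem, Nat.le_zero.1 hρ, pow_zero, mul_one]
  intro n hn i
  have h1 := mem_box.1 (hx n hn) i
  rw [hi_eq] at h1
  rw [hρ0, hk0]
  exact cellIdx_zero (sideLen_pos _ i) h1.1 h1.2

/-! ### Sums over the boxes of the partition -/

/-- The sum is evaluated one coordinate at a time; both intervals with the same `d / 2` give the
same contribution, hence the factor `2 ^ s`. -/
lemma tsum_decay (s : ℕ) : ∀ L : ℕ, ∑' d : Fin s → ℕ, (2⁻¹ : ℝ≥0∞) ^ (∑ i, d i / 2 - L)
    = 2 ^ s * (binomSum (s + 1) (L + s) : ℝ≥0∞) := by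
  induction s with
  | zero => intro L; simp [binomSum]
  | succ s ih =>
    intro L
    set g : ℕ → ℝ≥0∞ := fun b => ∑' d : Fin s → ℕ, (2⁻¹ : ℝ≥0∞) ^ (b + ∑ i, d i / 2 - L) with hg
    have h1 : ∑' d : Fin (s + 1) → ℕ, (2⁻¹ : ℝ≥0∞) ^ (∑ i, d i / 2 - L) = ∑' a, g (a / 2) := by
      rw [← (Fin.consEquiv fun _ : Fin (s + 1) => ℕ).tsum_eq, ENNReal.tsum_prod']
      simp [hg, Fin.consEquiv, Fin.sum_univ_succ]
    have h2 : ∑' a, g (a / 2) = 2 * ∑' b, g b := by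
      rw [← tsum_even_add_odd ENNReal.summable ENNReal.summable, two_mul]
      congr 1
      · exact tsum_congr fun k => by congr 1; omega
      · exact tsum_congr fun k => by congr 1; omega
    have h3 : ∑' b, g b = ∑ b ∈ Finset.range (L + 1), g b + ∑' k, g (k + (L + 1)) :=
      (ENNReal.summable.sum_add_tsum_nat_add' (k := L + 1)).symm
    have h4 : ∑ b ∈ Finset.range (L + 1), g b
        = ∑ j ∈ Finset.range (L + 1), 2 ^ s * (binomSum (s + 1) (j + s) : ℝ≥0∞) := by
      rw [← Finset.sum_range_reflect]
      refine Finset.sum_congr rfl fun j hj => ?_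
      rw [Finset.mem_range] at hj
      rw [← ih j]
      exact tsum_congr fun d => by congr 1; omega
    have h5 : ∀ k, g (k + (L + 1)) = 2⁻¹ ^ (k + 1) * (2 ^ s * 2 ^ s) := by
      intro k
      have h6 := ih 0
      have h7 : binomSum (s + 1) (0 + s) = 2 ^ s := by
        rw [zero_add]; exact Nat.sum_range_choose s
      rw [h7] at h6
      push_cast at h6
      rw [← h6, ← ENNReal.tsum_mul_left]
      exact tsum_congr fun d => by rw [← pow_add]; congr 1; omega
    have h8 : ∑' k, (2⁻¹ : ℝ≥0∞) ^ (k + 1) = 1 := by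
      rw [ENNReal.tsum_geometric_add_one, ENNReal.one_sub_inv_two, inv_inv]
      exact ENNReal.inv_mul_cancel (by norm_num) (by norm_num)
    rw [h1, h2, h3, h4, tsum_congr h5, ENNReal.tsum_mul_right, h8, ← sum_binomSum_add]
    push_cast
    rw [← Finset.mul_sum]
    ring

/-- The Cauchy-Schwarz inequality for families with a countable and a finite index. -/
lemma tsum_sum_mul_le {A B : Type} [Fintype B] (w a : A → B → ℝ≥0∞) :
    ∑' d, ∑ u, w d u * a d u
      ≤ (∑' d, ∑ u, w d u ^ 2) ^ (1 / 2 : ℝ) * (∑' d, ∑ u, a d u ^ 2) ^ (1 / 2 : ℝ) := by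
  have h0 : ∀ g : A → B → ℝ≥0∞, ∑' d, ∑ u, g d u = ∑' z : A × B, g z.1 z.2 := by
    intro g
    rw [ENNReal.tsum_prod]
    exact tsum_congr fun d => (tsum_fintype _).symm
  let _ : MeasurableSpace (A × B) := ⊤
  have h := ENNReal.lintegral_mul_le_Lp_mul_Lq (Measure.count : Measure (A × B))
    (Real.HolderConjugate.two_two) (f := fun z => w z.1 z.2) (g := fun z => a z.1 z.2)
    (measurable_from_top).aemeasurable (measurable_from_top).aemeasurable
  simp only [lintegral_count, Pi.mul_apply, ENNReal.rpow_two] at h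
  rw [h0 fun d u => w d u * a d u, h0 fun d u => w d u ^ 2, h0 fun d u => a d u ^ 2]
  exact h

lemma sum_four_pow_card (s : ℕ) : ∑ u : Finset (Fin s), (4 : ℝ) ^ u.card = 5 ^ s := by
  have h := Fintype.sum_pow_mul_eq_add_pow (Fin s) (4 : ℝ) 1
  simp only [one_pow, mul_one, Fintype.card_fin] at h
  rw [h]; norm_num

/-! ### The weights -/

/-- In one coordinate, the growth of a power of the length of an interval is compensated by the
weight of the interval up to a decay of order `α`. -/
lemma rpow_mul_inv_one_add_le {α β : ℝ} (hα : 0 < α) (hβ : 0 ≤ β) (e : ℕ) :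
    ((2 : ℝ) ^ (e - 1)) ^ β * (1 + sideDist e ^ (α + β))⁻¹ ≤ 2 ^ α * (2 ^ (-α)) ^ e := by
  rcases Nat.eq_zero_or_pos e with rfl | he
  · have h1 : (1 : ℝ) ≤ 2 ^ α := Real.one_le_rpow (by norm_num) hα.le
    simpa [sideDist, Real.zero_rpow (by linarith : α + β ≠ 0)] using h1
  · rw [sideDist, if_neg (by omega)]
    set y : ℝ := 2 ^ (e - 1) with hy
    have hy0 : 0 < y := by positivity
    have h1 : (2 : ℝ) ^ α * (2 ^ (-α)) ^ e = y ^ (-α) := by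
      rw [hy, ← Real.rpow_natCast, ← Real.rpow_mul (by norm_num), ← Real.rpow_add (by norm_num),
        ← Real.rpow_natCast, ← Real.rpow_mul (by norm_num)]
      congr 1
      push_cast [Nat.cast_sub (show 1 ≤ e from he)]
      ring
    rw [h1, ← div_eq_mul_inv, div_le_iff₀ (by positivity), mul_add, ← Real.rpow_add hy0]
    have h2 : 0 < y ^ (-α) := by positivity
    rw [show -α + (α + β) = β by ring]
    linarith

lemma prod_rpow_mul_prod_le {α β : ℝ} (hα : 0 < α) (hβ : 0 ≤ β) {s : ℕ} (d : Fin s → ℕ)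
    (u : Finset (Fin s)) :
    (∏ i ∈ u, sideLen (ratBox d) i) ^ β *
        ∏ i, (1 + min |lo 2 (ratBox d) i| |hi 2 (ratBox d) i| ^ (α + β))⁻¹
      ≤ (2 ^ α) ^ s * (2 ^ (-α)) ^ ∑ i, d i / 2 := by
  have h1 : (∏ i ∈ u, sideLen (ratBox d) i) ^ β ≤ ∏ i, ((2 : ℝ) ^ (d i / 2 - 1)) ^ β := by
    rw [Real.finsetProd_rpow _ _ fun i _ => by positivity]
    refine Real.rpow_le_rpow (Finset.prod_nonneg fun i _ => (sideLen_pos _ i).le) ?_ hβ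
    simp only [sideLen_ratBox]
    exact Finset.prod_le_prod_of_subset_of_one_le (Finset.subset_univ u)
      (fun i _ => by positivity) fun i _ _ => one_le_pow₀ (by norm_num)
  simp only [lo_ratBox, hi_ratBox, min_abs_side]
  have h0 : ∀ i, 0 < (1 + sideDist (d i / 2) ^ (α + β))⁻¹ := fun i => by
    have := Real.rpow_nonneg (sideDist_nonneg (d i / 2)) (α + β)
    positivity
  calc _ ≤ (∏ i, ((2 : ℝ) ^ (d i / 2 - 1)) ^ β) * ∏ i, (1 + sideDist (d i / 2) ^ (α + β))⁻¹ :=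
        mul_le_mul_of_nonneg_right h1 (Finset.prod_nonneg fun i _ => (h0 i).le)
    _ = ∏ i, (((2 : ℝ) ^ (d i / 2 - 1)) ^ β * (1 + sideDist (d i / 2) ^ (α + β))⁻¹) := by
        rw [Finset.prod_mul_distrib]
    _ ≤ ∏ i, ((2 : ℝ) ^ α * (2 ^ (-α)) ^ (d i / 2)) :=
        Finset.prod_le_prod (fun i _ => mul_nonneg (by positivity) (h0 i).le)
          fun i _ => rpow_mul_inv_one_add_le hα hβ _
    _ = _ := by
        rw [Finset.prod_mul_distrib, Finset.prod_pow_eq_pow_sum]; simp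

lemma ratWeight_pos (s : ℕ) (α : ℝ) (u : Finset (Fin s)) (p : BoxIdx s) :
    0 < ratWeight s α u p := by
  unfold ratWeight
  split_ifs <;> exact Finset.prod_pos fun i _ => by positivity

lemma rpow_half_mul_ratWeight_le {α : ℝ} (hα : 0 < α) {s : ℕ} (d : Fin s → ℕ) :
    (∏ i, sideLen (ratBox d) i) ^ (1 / 2 : ℝ) * ratWeight s α ∅ (ratBox d)
      ≤ (2 ^ α) ^ s * (2 ^ (-α)) ^ ∑ i, d i / 2 := by
  rw [ratWeight, if_pos rfl]
  exact prod_rpow_mul_prod_le hα (by norm_num) d Finset.univ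

lemma rpow_mul_ratWeight_le {α : ℝ} (hα : 0 < α) {s : ℕ} (d : Fin s → ℕ) {u : Finset (Fin s)}
    (hu : u ≠ ∅) :
    (∏ i ∈ u, sideLen (ratBox d) i) ^ (α + 1 / 2) * ratWeight s α u (ratBox d)
      ≤ (2 ^ α) ^ s * (2 ^ (-α)) ^ ∑ i, d i / 2 := by
  rw [ratWeight, if_neg hu, show 2 * α + 1 / 2 = α + (α + 1 / 2) by ring]
  exact prod_rpow_mul_prod_le hα (by linarith) d u

/-! ### Weighted local variations and integrability -/

/-- The weighted local variation `γ_u(J)⁻¹ V_{J,u}(f)` for the box `J` with number `d`. -/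
def weightedVar (s : ℕ) (α : ℝ) (f : (Fin s → ℝ) → ℝ) (d : Fin s → ℕ) (u : Finset (Fin s)) :
    ℝ≥0∞ :=
  (ENNReal.ofReal (ratWeight s α u (ratBox d)))⁻¹ * localVar 2 α (ratBox d) u f

lemma ofReal_mul_weightedVar (s : ℕ) (α : ℝ) (f : (Fin s → ℝ) → ℝ) (d : Fin s → ℕ)
    (u : Finset (Fin s)) :
    ENNReal.ofReal (ratWeight s α u (ratBox d)) * weightedVar s α f d u
      = localVar 2 α (ratBox d) u f := by
  rw [weightedVar, ← mul_assoc, ENNReal.mul_inv_cancel, one_mul]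
  · simpa using ratWeight_pos s α u (ratBox d)
  · exact ENNReal.ofReal_ne_top

lemma hkVar_eq (s : ℕ) (α : ℝ) (f : (Fin s → ℝ) → ℝ) :
    hkVar 2 (ratPartition s) (constSmooth s α) (ratWeight s α) f
      = (∑' d : Fin s → ℕ, ∑ u, weightedVar s α f d u ^ 2) ^ (1 / 2 : ℝ) := by
  rw [hkVar, ← (ratEquiv s).tsum_eq]
  rfl

lemma weightedVar_lt_top {s : ℕ} {α : ℝ} {f : (Fin s → ℝ) → ℝ}
    (hf : hkVar 2 (ratPartition s) (constSmooth s α) (ratWeight s α) f < ∞) (d : Fin s → ℕ)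
    (u : Finset (Fin s)) : weightedVar s α f d u < ∞ := by
  rw [hkVar_eq, ENNReal.rpow_lt_top_iff_of_pos (by norm_num)] at hf
  have h1 : weightedVar s α f d u ^ 2 < ∞ :=
    ((Finset.single_le_sum (f := fun u => weightedVar s α f d u ^ 2) (fun _ _ => zero_le)
      (Finset.mem_univ u)).trans (ENNReal.le_tsum d)).trans_lt hf
  exact (ENNReal.pow_lt_top_iff.1 h1).resolve_right (by norm_num)

lemma measurableSet_elemInterval (b : ℕ) {s : ℕ} (p : BoxIdx s) :
    MeasurableSet (elemInterval b p) := measurableSet_box _ _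

lemma lintegral_enorm_elemInterval_le {s : ℕ} {α : ℝ} (hα : 0 < α) {f : (Fin s → ℝ) → ℝ}
    (hf : Continuous f) (d : Fin s → ℕ) :
    ∫⁻ x in elemInterval 2 (ratBox d), ‖f x‖ₑ
      ≤ ENNReal.ofReal ((2 ^ α) ^ s * (2 ^ (-α)) ^ ∑ i, d i / 2) * weightedVar s α f d ∅ := by
  set J := elemInterval 2 (ratBox d) with hJ
  have hm : Measurable fun x => ‖f x‖ₑ := hf.measurable.enorm
  have h := ENNReal.lintegral_mul_le_Lp_mul_Lq (volume.restrict J)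
    (Real.HolderConjugate.two_two) (f := fun x => ‖f x‖ₑ) (g := fun _ => 1)
    hm.aemeasurable aemeasurable_const
  simp only [Pi.mul_apply, mul_one, ENNReal.rpow_two, one_pow, lintegral_const,
    Measure.restrict_apply_univ, one_mul] at h
  have hvol : volume J = ENNReal.ofReal (∏ i, sideLen (ratBox d) i) := by
    rw [← boxVol_eq_prod_sideLen, ← volume_real_box (lo_le_hi _), measureReal_def,
      ENNReal.ofReal_toReal (volume_box_lt_top _ _).ne]
    rfl
  have hpos : 0 < ∏ i, sideLen (ratBox d) i := Finset.prod_pos fun i _ => sideLen_pos _ i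
  have h2 := ofReal_mul_weightedVar s α f d ∅
  rw [localVar, if_pos rfl] at h2
  rw [hvol, ENNReal.ofReal_rpow_of_pos hpos, ← h2] at h
  refine h.trans ?_
  rw [mul_right_comm, ← ENNReal.ofReal_mul (ratWeight_pos _ _ _ _).le]
  refine mul_le_mul_left ?_ _
  refine ENNReal.ofReal_le_ofReal ?_
  rw [mul_comm]
  exact rpow_half_mul_ratWeight_le hα d

lemma two_rpow_neg_sq_le {α : ℝ} (hα : 1 / 2 ≤ α) : ((2 : ℝ) ^ (-α)) ^ 2 ≤ 2⁻¹ := by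
  rw [← Real.rpow_natCast, ← Real.rpow_mul (by norm_num), ← Real.rpow_neg_one]
  exact Real.rpow_le_rpow_of_exponent_le (by norm_num) (by push_cast; linarith)

/-- The square sum of the constants in the local error bounds. -/
lemma tsum_sum_sq_le {α : ℝ} (hα : 1 / 2 ≤ α) (s L : ℕ) {K : ℝ} (hK : 0 ≤ K) :
    ∑' d : Fin s → ℕ, ∑ u : Finset (Fin s),
        ENNReal.ofReal (K * (2 ^ (-α)) ^ (∑ i, d i / 2 - L) * 2 ^ u.card) ^ 2
      ≤ ENNReal.ofReal (K ^ 2 * 5 ^ s * (2 ^ s * binomSum (s + 1) (L + s))) := by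
  have h1 : ∀ d : Fin s → ℕ, ∑ u : Finset (Fin s),
        ENNReal.ofReal (K * (2 ^ (-α)) ^ (∑ i, d i / 2 - L) * 2 ^ u.card) ^ 2
      ≤ ENNReal.ofReal (K ^ 2 * 5 ^ s) * 2⁻¹ ^ (∑ i, d i / 2 - L) := by
    intro d
    set j := ∑ i, d i / 2 - L
    simp only [← ENNReal.ofReal_pow (show 0 ≤ K * (2 ^ (-α)) ^ j * 2 ^ _ by positivity)]
    rw [← ENNReal.ofReal_sum_of_nonneg fun u _ => by positivity]
    have h2 : (2⁻¹ : ℝ≥0∞) = ENNReal.ofReal 2⁻¹ := by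
      rw [ENNReal.ofReal_inv_of_pos (by norm_num)]; simp
    rw [h2, ← ENNReal.ofReal_pow (by norm_num), ← ENNReal.ofReal_mul (by positivity)]
    refine ENNReal.ofReal_le_ofReal ?_
    have h3 : ∀ u : Finset (Fin s), (K * (2 ^ (-α)) ^ j * 2 ^ u.card) ^ 2
        = K ^ 2 * (((2 : ℝ) ^ (-α)) ^ 2) ^ j * 4 ^ u.card := by
      intro u
      rw [mul_pow, mul_pow, ← pow_mul, ← pow_mul, ← pow_mul, mul_comm j, mul_comm u.card,
        pow_mul 2 2 u.card]
      norm_num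
    simp only [h3]
    rw [← Finset.mul_sum, sum_four_pow_card]
    calc K ^ 2 * (((2 : ℝ) ^ (-α)) ^ 2) ^ j * 5 ^ s ≤ K ^ 2 * 2⁻¹ ^ j * 5 ^ s := by
          have := pow_le_pow_left₀ (by positivity) (two_rpow_neg_sq_le hα) j
          gcongr
      _ = _ := by ring
  refine (ENNReal.tsum_le_tsum h1).trans (le_of_eq ?_)
  rw [ENNReal.tsum_mul_left, tsum_decay, ENNReal.ofReal_mul (by positivity) (q := _ * _)]
  congr 1
  rw [ENNReal.ofReal_mul (by positivity), ENNReal.ofReal_pow (by norm_num)]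
  simp

lemma integrable_of_mem_funClass {s : ℕ} {α : ℝ} (hα : 1 / 2 ≤ α) {f : (Fin s → ℝ) → ℝ}
    (hf : f ∈ funClass 2 (ratPartition s) (constSmooth s α) (ratWeight s α)) : Integrable f := by
  refine ⟨hf.1.aestronglyMeasurable, ?_⟩
  have h1 : ∫⁻ x, ‖f x‖ₑ = ∑' d : Fin s → ℕ, ∫⁻ x in elemInterval 2 (ratBox d), ‖f x‖ₑ := by
    rw [← lintegral_iUnion (fun d : Fin s → ℕ => measurableSet_elemInterval 2 (ratBox d))
      (pairwise_disjoint_elemInterval_ratBox s), iUnion_elemInterval_ratBox,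
      Measure.restrict_univ]
  set K : ℝ := (2 ^ α) ^ s with hK
  have h2 : ∀ d : Fin s → ℕ, ∫⁻ x in elemInterval 2 (ratBox d), ‖f x‖ₑ
      ≤ ∑ u : Finset (Fin s), ENNReal.ofReal (K * (2 ^ (-α)) ^ (∑ i, d i / 2 - 0) * 2 ^ u.card)
        * weightedVar s α f d u := by
    intro d
    refine (lintegral_enorm_elemInterval_le (α := α) (by linarith) hf.1 d).trans ?_
    have := Finset.single_le_sum (f := fun u : Finset (Fin s) =>
      ENNReal.ofReal (K * (2 ^ (-α)) ^ (∑ i, d i / 2 - 0) * 2 ^ u.card)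
        * weightedVar s α f d u) (fun _ _ => zero_le) (Finset.mem_univ ∅)
    simpa using this
  rw [HasFiniteIntegral, h1]
  refine ((ENNReal.tsum_le_tsum h2).trans (tsum_sum_mul_le _ _)).trans_lt ?_
  rw [← hkVar_eq]
  refine ENNReal.mul_lt_top ?_ hf.2
  rw [ENNReal.rpow_lt_top_iff_of_pos (by norm_num)]
  exact (tsum_sum_sq_le hα s 0 (by positivity)).trans_lt ENNReal.ofReal_lt_top

/-! ### The worst-case error -/

section Error

variable {s m : ℕ} {C : Fin s → Matrix (Fin m) (Fin m) (ZMod 2)}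

lemma localWeight_eq {d : Fin s → ℕ} {n : ℕ} (hn : n ∈ nodesIn m s C d) :
    localWeight 2 (ratPartition s) (2 ^ m) (ratNode m s C) n
      = boxVol (lo 2 (ratBox d)) (hi 2 (ratBox d)) / (nodesIn m s C d).card := by
  have hn' := (mem_nodesIn.1 hn).2
  have hmem : ratBox d ∈ ratPartition s := range_ratBox s ▸ Set.mem_range_self d
  have h : ∃ p ∈ ratPartition s, ratNode m s C n ∈ elemInterval 2 p := ⟨_, hmem, hn'⟩
  have hch : h.choose = ratBox d := by
    obtain ⟨h1, h2⟩ := h.choose_spec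
    obtain ⟨d', hd'⟩ : h.choose ∈ Set.range ratBox := (range_ratBox s).ge h1
    rw [← hd'] at h2
    rw [← hd', ratBox_unique h2 hn']
  rw [localWeight, dif_pos h, hch, nodeCount, ← Set.ncard_coe_finset]
  congr 4
  ext k
  simp [mem_nodesIn]

/-- The part of the quadrature rule that belongs to the box with number `d`. -/
def localRule (m : ℕ) (C : Fin s → Matrix (Fin m) (Fin m) (ZMod 2)) (f : (Fin s → ℝ) → ℝ)
    (d : Fin s → ℕ) : ℝ :=
  boxVol (lo 2 (ratBox d)) (hi 2 (ratBox d)) / (nodesIn m s C d).card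
    * ∑ n ∈ nodesIn m s C d, f (ratNode m s C n)

lemma hasSum_localRule (f : (Fin s → ℝ) → ℝ) :
    HasSum (localRule m C f) (quadRule (2 ^ m) (ratNode m s C)
      (localWeight 2 (ratPartition s) (2 ^ m) (ratNode m s C)) f) := by
  classical
  choose δ hδ using fun n => ratBox_exists (ratNode m s C n)
  have hfib : ∀ d, (Finset.range (2 ^ m)).filter (fun n => δ n = d) = nodesIn m s C d := by
    intro d
    ext n
    rw [Finset.mem_filter, Finset.mem_range, mem_nodesIn]
    exact and_congr_right fun _ => ⟨fun h => h ▸ hδ n, fun h => ratBox_unique (hδ n) h⟩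
  set S := (Finset.range (2 ^ m)).image δ with hS
  have h1 : quadRule (2 ^ m) (ratNode m s C)
      (localWeight 2 (ratPartition s) (2 ^ m) (ratNode m s C)) f = ∑ d ∈ S, localRule m C f d := by
    rw [quadRule, ← Finset.sum_fiberwise_of_maps_to (g := δ) (t := S)
      fun n hn => Finset.mem_image_of_mem _ hn]
    refine Finset.sum_congr rfl fun d _ => ?_
    rw [hfib, localRule, Finset.mul_sum]
    exact Finset.sum_congr rfl fun n hn => by rw [localWeight_eq hn]
  rw [h1]
  refine hasSum_sum_of_ne_finset_zero fun d hd => ?_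
  have h2 : nodesIn m s C d = ∅ := by
    rw [← hfib, Finset.filter_eq_empty_iff]
    rintro n hn rfl
    exact hd (Finset.mem_image_of_mem _ hn)
  simp [localRule, h2]

/-- The local variations enter the bound of the local error after division by the weights. -/
lemma abs_localRule_sub_le {α : ℝ} (hα : 1 / 2 ≤ α) {f : (Fin s → ℝ) → ℝ}
    (hf : f ∈ funClass 2 (ratPartition s) (constSmooth s α) (ratWeight s α)) {d : Fin s → ℕ}
    (hne : (nodesIn m s C d).Nonempty) {M : ℕ}
    (hM : EvenlyDistributed (ratBox d) (nodesIn m s C d) (ratNode m s C) M) :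
    |localRule m C f d - ∫ y in elemInterval 2 (ratBox d), f y|
      ≤ ∑ u : Finset (Fin s), (2 ^ α) ^ s * (2 ^ (-α)) ^ (∑ i, d i / 2 + M)
          * ((2 : ℝ) ^ (-α))⁻¹ ^ u.card * (binomSum u.card M : ℝ)
          * (weightedVar s α f d u).toReal := by
  set V : Finset (Fin s) → ℝ := fun u =>
    ratWeight s α u (ratBox d) * (weightedVar s α f d u).toReal with hV
  have hV0 : ∀ u, 0 ≤ V u := fun u =>
    mul_nonneg (ratWeight_pos _ _ _ _).le ENNReal.toReal_nonneg
  refine (abs_boxVol_mul_sum_sub_integral_le hα hf.1 hne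
    (fun n hn => (mem_nodesIn.1 hn).2) hM V hV0 fun u hu => le_of_eq ?_).trans ?_
  · have h1 := ofReal_mul_weightedVar s α f d u
    rw [localVar, if_neg hu.ne_empty] at h1
    rw [← h1, hV, ENNReal.ofReal_mul (ratWeight_pos _ _ _ _).le,
      ENNReal.ofReal_toReal (weightedVar_lt_top hf.2 d u).ne]
  · refine Finset.sum_le_sum fun u _ => ?_
    rcases u.eq_empty_or_nonempty with rfl | hu
    · simp [binomSum]
    have h1 := rpow_mul_ratWeight_le (α := α) (by linarith) d hu.ne_empty
    have h2 : 0 ≤ (weightedVar s α f d u).toReal := ENNReal.toReal_nonneg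
    have h3 : 0 ≤ (2 ^ (-α)) ^ M * ((2 : ℝ) ^ (-α))⁻¹ ^ u.card * (binomSum u.card M : ℝ)
        * (weightedVar s α f d u).toReal := by positivity
    calc _ = ((∏ i ∈ u, sideLen (ratBox d) i) ^ (α + 1 / 2) * ratWeight s α u (ratBox d))
          * ((2 ^ (-α)) ^ M * ((2 : ℝ) ^ (-α))⁻¹ ^ u.card * (binomSum u.card M : ℝ)
            * (weightedVar s α f d u).toReal) := by simp only [hV]; ring
      _ ≤ _ := mul_le_mul_of_nonneg_right h1 h3
      _ = _ := by rw [pow_add]; ring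

/-- The local error in any box, whether it is near the origin and contains many nodes, or far away
and contains some or none. -/
lemma enorm_localRule_sub_le {t : ℕ} {α : ℝ} (hα : 1 / 2 < α) (hα' : α ≤ 1) (hs : 2 ≤ s)
    (hm : t + 3 * s < m) (hC : IsDigitalNet 2 t m s C) {f : (Fin s → ℝ) → ℝ}
    (hf : f ∈ funClass 2 (ratPartition s) (constSmooth s α) (ratWeight s α)) (d : Fin s → ℕ) :
    ‖localRule m C f d - ∫ y in elemInterval 2 (ratBox d), f y‖ₑ
      ≤ ∑ u : Finset (Fin s), ENNReal.ofReal ((2 ^ α) ^ s * (2 ^ (-α)) ^ (m - t - 2 * s)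
          * (2 ^ s * (m - t - 2 * s).choose s)
          * (2 ^ (-α)) ^ (∑ i, d i / 2 - (m - t - 2 * s)) * 2 ^ u.card)
        * weightedVar s α f d u := by
  set L := m - t - 2 * s with hL
  set q : ℝ := 2 ^ (-α) with hq
  have hq0 : 0 < q := by positivity
  have hqinv : q⁻¹ ≤ 2 := by
    rw [hq, ← Real.rpow_neg (by norm_num), neg_neg]
    simpa using Real.rpow_le_rpow_of_exponent_le (by norm_num : (1 : ℝ) ≤ 2) hα'
  have hchoose : (1 : ℝ) ≤ L.choose s := by
    exact_mod_cast Nat.choose_pos (by omega)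
  have h2s : (1 : ℝ) ≤ 2 ^ s := one_le_pow₀ (by norm_num)
  rcases (nodesIn m s C d).eq_empty_or_nonempty with hemp | hne
  · -- without nodes, the error is the integral, which the `L²` norm controls
    have hlt : L < ∑ i, d i / 2 := by
      by_contra! h
      exact (nodesIn_evenlyDistributed hs hm hC d h).1.ne_empty hemp
    have h0 : localRule m C f d = 0 := by simp [localRule, hemp]
    rw [h0, zero_sub, enorm_neg]
    refine (enorm_integral_le_lintegral_enorm _).trans ?_
    refine (lintegral_enorm_elemInterval_le (α := α) (by linarith) hf.1 d).trans ?_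
    refine le_trans ?_ (Finset.single_le_sum (fun _ _ => zero_le) (Finset.mem_univ ∅))
    refine mul_le_mul_left (ENNReal.ofReal_le_ofReal ?_) _
    rw [Finset.card_empty, pow_zero, mul_one]
    have h1 : q ^ (∑ i, d i / 2) = q ^ L * q ^ (∑ i, d i / 2 - L) := by
      rw [← pow_add]; congr 1; omega
    rw [← hq, h1]
    have h2 : (1 : ℝ) ≤ 2 ^ s * L.choose s := one_le_mul_of_one_le_of_one_le h2s hchoose
    calc (2 ^ α) ^ s * (q ^ L * q ^ (∑ i, d i / 2 - L))
        = (2 ^ α) ^ s * q ^ L * 1 * q ^ (∑ i, d i / 2 - L) := by ring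
      _ ≤ _ := by gcongr
  · have hM : EvenlyDistributed (ratBox d) (nodesIn m s C d) (ratNode m s C)
        (L - ∑ i, d i / 2) := by
      rcases le_or_gt (∑ i, d i / 2) L with h | h
      · exact (nodesIn_evenlyDistributed hs hm hC d h).2
      · rw [Nat.sub_eq_zero_of_le h.le]
        exact evenlyDistributed_zero fun n hn => (mem_nodesIn.1 hn).2
    have h1 := abs_localRule_sub_le hα.le hf hne hM
    rw [Real.enorm_eq_ofReal_abs]
    refine (ENNReal.ofReal_le_ofReal h1).trans ?_
    rw [ENNReal.ofReal_sum_of_nonneg fun u _ => by positivity]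
    refine Finset.sum_le_sum fun u _ => ?_
    have h2 : weightedVar s α f d u = ENNReal.ofReal (weightedVar s α f d u).toReal :=
      (ENNReal.ofReal_toReal (weightedVar_lt_top hf.2 d u).ne).symm
    rw [h2, ← ENNReal.ofReal_mul (by positivity), ENNReal.toReal_ofReal ENNReal.toReal_nonneg]
    refine ENNReal.ofReal_le_ofReal (mul_le_mul_of_nonneg_right ?_ ENNReal.toReal_nonneg)
    have h3 : (binomSum u.card (L - ∑ i, d i / 2) : ℝ) ≤ 2 ^ s * L.choose s := by
      have h4 : u.card ≤ s := by simpa using Finset.card_le_univ u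
      have h5 := (binomSum_mono h4 (Nat.sub_le L (∑ i, d i / 2))).trans
        (binomSum_le_two_pow_mul_choose (by omega) (by omega : s + 1 ≤ L))
      exact_mod_cast h5
    have h6 : q ^ (∑ i, d i / 2 + (L - ∑ i, d i / 2)) = q ^ L * q ^ (∑ i, d i / 2 - L) := by
      rw [← pow_add]; congr 1; omega
    have h7 : q⁻¹ ^ u.card ≤ 2 ^ u.card := pow_le_pow_left₀ (by positivity) hqinv _
    rw [← hq, h6]
    calc (2 ^ α) ^ s * (q ^ L * q ^ (∑ i, d i / 2 - L)) * q⁻¹ ^ u.card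
          * (binomSum u.card (L - ∑ i, d i / 2) : ℝ)
        ≤ (2 ^ α) ^ s * (q ^ L * q ^ (∑ i, d i / 2 - L)) * 2 ^ u.card
          * (2 ^ s * L.choose s) := by gcongr
      _ = _ := by ring

/-- The error for a function in the class, before the constants are simplified. -/
lemma ofReal_abs_quadRule_sub_le {t : ℕ} {α : ℝ} (hα : 1 / 2 < α) (hα' : α ≤ 1) (hs : 2 ≤ s)
    (hm : t + 3 * s < m) (hC : IsDigitalNet 2 t m s C) {f : (Fin s → ℝ) → ℝ}
    (hf : f ∈ funClass 2 (ratPartition s) (constSmooth s α) (ratWeight s α)) :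
    ENNReal.ofReal |quadRule (2 ^ m) (ratNode m s C)
        (localWeight 2 (ratPartition s) (2 ^ m) (ratNode m s C)) f - ∫ y, f y|
      ≤ ENNReal.ofReal (((2 ^ α) ^ s * (2 ^ (-α)) ^ (m - t - 2 * s)
          * (2 ^ s * (m - t - 2 * s).choose s)) ^ 2 * 5 ^ s
          * (2 ^ s * binomSum (s + 1) (m - t - 2 * s + s))) ^ (1 / 2 : ℝ)
        * hkVar 2 (ratPartition s) (constSmooth s α) (ratWeight s α) f := by
  have hint := integrable_of_mem_funClass hα.le hf
  have h1 : HasSum (fun d : Fin s → ℕ => ∫ y in elemInterval 2 (ratBox d), f y) (∫ y, f y) := by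
    have h := hasSum_integral_iUnion
      (fun d : Fin s → ℕ => measurableSet_elemInterval 2 (ratBox d))
      (pairwise_disjoint_elemInterval_ratBox s) hint.integrableOn
    rwa [iUnion_elemInterval_ratBox, Measure.restrict_univ] at h
  have h2 := (hasSum_localRule (m := m) (C := C) f).sub h1
  rw [← Real.enorm_eq_ofReal_abs, ← h2.tsum_eq]
  refine enorm_tsum_le_tsum_enorm.trans ?_
  refine (ENNReal.tsum_le_tsum fun d => enorm_localRule_sub_le hα hα' hs hm hC hf d).trans ?_
  refine (tsum_sum_mul_le _ _).trans ?_
  rw [← hkVar_eq]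
  refine mul_le_mul_left (ENNReal.rpow_le_rpow ?_ (by norm_num)) _
  exact tsum_sum_sq_le hα.le s _ (by positivity)

end Error

/-- The comparison of the constants. Apart from common factors and powers of the binomial
coefficient it reduces to `160 ^ s ≤ (16 * (1 + 2 ^ (3 / 2)) ^ 2) ^ s`. -/
lemma sqrt_constant_le {α : ℝ} {s t m : ℕ} (hm : t + 3 * s < m) :
    √(((2 ^ α) ^ s * (2 ^ (-α)) ^ (m - t - 2 * s)
          * (2 ^ s * (m - t - 2 * s).choose s)) ^ 2 * 5 ^ s
          * (2 ^ s * binomSum (s + 1) (m - t - 2 * s + s)))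
      ≤ (2 : ℝ) ^ (-α * ((m : ℝ) - (t : ℝ))) * ((m - t - 2 * s).choose s : ℝ) ^ 2 *
          (2 : ℝ) ^ ((s : ℝ) * (3 * α + 2)) *
          ((2 : ℝ) ^ (-α) + 2 * (1 + (2 : ℝ) ^ (3 / 2 : ℝ)) ^ s) := by
  set L := m - t - 2 * s with hL
  set c : ℝ := ((L.choose s : ℕ) : ℝ) with hc
  set A : ℝ := (2 ^ α) ^ s * (2 ^ (-α)) ^ L with hA
  have hc1 : 1 ≤ c := by rw [hc]; exact_mod_cast Nat.choose_pos (by omega)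
  have hA0 : 0 < A := by positivity
  have hexp : (2 : ℝ) ^ (-α * ((m : ℝ) - (t : ℝ))) * (2 : ℝ) ^ ((s : ℝ) * (3 * α + 2))
      = A * 4 ^ s := by
    have hLr : (L : ℝ) = (m : ℝ) - t - 2 * s := by
      rw [hL, Nat.cast_sub (by omega), Nat.cast_sub (by omega)]; push_cast; ring
    have h4 : (4 : ℝ) ^ s = 2 ^ ((2 : ℝ) * s) := by
      rw [Real.rpow_mul (by norm_num), Real.rpow_natCast]; norm_num
    rw [hA, h4, ← Real.rpow_natCast, ← Real.rpow_natCast, ← Real.rpow_mul (by norm_num),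
      ← Real.rpow_mul (by norm_num), ← Real.rpow_add (by norm_num), ← Real.rpow_add (by norm_num),
      ← Real.rpow_add (by norm_num), hLr]
    congr 1; ring
  set κ : ℝ := 1 + (2 : ℝ) ^ (3 / 2 : ℝ) with hκ
  have hκ2 : 10 ≤ κ ^ 2 := by
    have h1 : ((2 : ℝ) ^ (3 / 2 : ℝ)) ^ 2 = 8 := by
      rw [← Real.rpow_natCast, ← Real.rpow_mul (by norm_num)]; norm_num
    have h2 : 0 < (2 : ℝ) ^ (3 / 2 : ℝ) := by positivity
    nlinarith
  have hκ0 : 0 < κ := by positivity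
  have hb : (binomSum (s + 1) (L + s) : ℝ) ≤ 4 ^ s * c := by
    rw [hc]; exact_mod_cast binomSum_add_le_four_pow_mul_choose (by omega)
  have hR : (2 : ℝ) ^ (-α * ((m : ℝ) - (t : ℝ))) * c ^ 2 *
          (2 : ℝ) ^ ((s : ℝ) * (3 * α + 2)) * ((2 : ℝ) ^ (-α) + 2 * κ ^ s)
      = A * 4 ^ s * c ^ 2 * ((2 : ℝ) ^ (-α) + 2 * κ ^ s) := by rw [← hexp]; ring
  rw [hR]
  clear_value A c κ
  refine Real.sqrt_le_iff.2 ⟨by positivity, ?_⟩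
  calc (A * (2 ^ s * c)) ^ 2 * 5 ^ s * (2 ^ s * (binomSum (s + 1) (L + s) : ℝ))
      ≤ (A * (2 ^ s * c)) ^ 2 * 5 ^ s * (2 ^ s * (4 ^ s * c)) := by gcongr
    _ = A ^ 2 * c ^ 3 * 16 ^ s * 10 ^ s := by
        rw [show (16 : ℝ) = 2 * 2 * 4 by norm_num, show (10 : ℝ) = 5 * 2 by norm_num]
        simp only [mul_pow]; ring
    _ ≤ A ^ 2 * c ^ 4 * 16 ^ s * (κ ^ 2) ^ s := by
        have h1 : c ^ 3 ≤ c ^ 4 := pow_le_pow_right₀ hc1 (by norm_num)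
        gcongr
    _ = (A * 4 ^ s * c ^ 2 * κ ^ s) ^ 2 := by
        rw [show (16 : ℝ) = 4 * 4 by norm_num]
        simp only [mul_pow]; ring
    _ ≤ (A * 4 ^ s * c ^ 2 * ((2 : ℝ) ^ (-α) + 2 * κ ^ s)) ^ 2 := by
        have h2 : κ ^ s ≤ (2 : ℝ) ^ (-α) + 2 * κ ^ s := by
          have h3 : 0 < (2 : ℝ) ^ (-α) := by positivity
          have h4 : 0 < κ ^ s := by positivity
          linarith
        gcongr

lemma ratError_le {s t m : ℕ} {α : ℝ} (hα : 1 / 2 < α) (hα' : α ≤ 1) (hs : 2 ≤ s)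
    {C : Fin s → Matrix (Fin m) (Fin m) (ZMod 2)} (hC : IsDigitalNet 2 t m s C)
    (hm : t + 3 * s < m) :
    ratError m s α C ≤ ENNReal.ofReal
      ((2 : ℝ) ^ (-α * ((m : ℝ) - (t : ℝ))) * ((m - t - 2 * s).choose s : ℝ) ^ 2 *
        (2 : ℝ) ^ ((s : ℝ) * (3 * α + 2)) *
        ((2 : ℝ) ^ (-α) + 2 * (1 + (2 : ℝ) ^ (3 / 2 : ℝ)) ^ s)) := by
  refine iSup_le fun f => iSup_le fun hf => iSup_le fun hf1 => ?_
  refine (ofReal_abs_quadRule_sub_le hα hα' hs hm hC hf).trans ?_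
  refine (mul_le_mul_right hf1 _).trans ?_
  rw [mul_one, ENNReal.ofReal_rpow_of_nonneg (by positivity) (by norm_num), ← Real.sqrt_eq_rpow]
  exact ENNReal.ofReal_le_ofReal (sqrt_constant_le hm)

end DigitalQMC

end

theorem mainTheorem2 (s : ℕ) (hs : 2 ≤ s) (α : ℝ) (hα : 1 / 2 < α) (hα' : α ≤ 1) :
    (∀ f ∈ DigitalQMC.funClass 2 (DigitalQMC.ratPartition s) (DigitalQMC.constSmooth s α)
        (DigitalQMC.ratWeight s α), MeasureTheory.Integrable f) ∧
    (∀ (t m : ℕ) (C : Fin s → Matrix (Fin m) (Fin m) (ZMod 2)),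
      DigitalQMC.IsDigitalNet 2 t m s C → t + 3 * s < m →
      DigitalQMC.ratError m s α C ≤ ENNReal.ofReal
        ((2 : ℝ) ^ (-α * ((m : ℝ) - (t : ℝ))) * ((m - t - 2 * s).choose s : ℝ) ^ 2 *
          (2 : ℝ) ^ ((s : ℝ) * (3 * α + 2)) *
          ((2 : ℝ) ^ (-α) + 2 * (1 + (2 : ℝ) ^ (3 / 2 : ℝ)) ^ s))) ∧
    (∀ t : ℕ, ∃ K : ℝ, 0 < K ∧
      ∀ (m : ℕ) (C : Fin s → Matrix (Fin m) (Fin m) (ZMod 2)),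
        DigitalQMC.IsDigitalNet 2 t m s C → t + 3 * s < m →
        DigitalQMC.ratError m s α C ≤ ENNReal.ofReal
          (K * ((2 : ℝ) ^ m) ^ (-α) * Real.log ((2 : ℝ) ^ m) ^ (2 * s))) := by
  refine ⟨fun f hf => DigitalQMC.integrable_of_mem_funClass hα.le hf,
    fun t m C hC hm => DigitalQMC.ratError_le hα hα' hs hC hm, fun t => ?_⟩
  set B : ℝ := (2 : ℝ) ^ ((s : ℝ) * (3 * α + 2)) *
    ((2 : ℝ) ^ (-α) + 2 * (1 + (2 : ℝ) ^ (3 / 2 : ℝ)) ^ s) with hB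
  have hB0 : 0 < B := by positivity
  have hlog : 0 < Real.log 2 := Real.log_pos (by norm_num)
  refine ⟨2 ^ (α * t) * B / Real.log 2 ^ (2 * s), by positivity, fun m C hC hm => ?_⟩
  refine (DigitalQMC.ratError_le hα hα' hs hC hm).trans (ENNReal.ofReal_le_ofReal ?_)
  -- the binomial coefficient is at most `m ^ s`, and `m = log N / log 2`
  have h1 : ((m - t - 2 * s).choose s : ℝ) ^ 2 ≤ (m : ℝ) ^ (2 * s) := by
    rw [pow_mul']
    refine pow_le_pow_left₀ (by positivity) ?_ 2
    have h2 := (Nat.choose_le_pow (m - t - 2 * s) s).trans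
      (Nat.pow_le_pow_left (show m - t - 2 * s ≤ m by omega) s)
    exact_mod_cast h2
  have h3 : (2 : ℝ) ^ (-α * ((m : ℝ) - (t : ℝ))) = 2 ^ (α * t) * ((2 : ℝ) ^ m) ^ (-α) := by
    rw [← Real.rpow_natCast 2 m, ← Real.rpow_mul (by norm_num), ← Real.rpow_add (by norm_num)]
    congr 1; ring
  calc _ = 2 ^ (α * t) * ((2 : ℝ) ^ m) ^ (-α) * ((m - t - 2 * s).choose s : ℝ) ^ 2 * B := by
        rw [h3, hB]; ring
    _ ≤ 2 ^ (α * t) * ((2 : ℝ) ^ m) ^ (-α) * (m : ℝ) ^ (2 * s) * B := by gcongr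
    _ = _ := by
        rw [Real.log_pow, mul_pow]
        field_simp
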